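/- **Theorem (Convergence of gradient descent).** Let $N\ge 1$ be an integer, let $d_0,\dots,d_N$ be layer widths, $n=d_N$, $m=d_0$, and let $\Sigma_0\in\mathbb{R}^{n\times n}$ be symmetric positive semidefinite. For $W\in\mathbb{R}^{n\times m}$ let $$L^1(W)=\operatorname{tr}\Big(WW^\top+\Sigma_0-2\big(\Sigma_0^{1/2}WW^\top\Sigma_0^{1/2}\big)^{1/2}\Big)$$ be the squared Bures–Wasserstein distance between $WW^\top$ and $\Sigma_0$, and for a tuple $\overrightarrow{W}=(W_1,\dots,W_N)$ with $W_j\in\mathbb{R}^{d_j\times d_{j-1}}$ let $L^N(\overrightarrow{W})=L^1(W_N\cdots W_1)$. For a step size $\eta>0$ consider gradient descent $$\overrightarrow{W}(k+1)=\overrightarrow{W}(k)-\eta\,\nabla L^N(\overrightarrow{W}(k)),\qquad k=0,1,2,\dots,$$ and write $W(0)=W_N(0)\cdots W_1(0)$. Assume that * the initial weights are balanced: $W_j(0)W_j(0)^\top=W_{j+1}(0)^\top W_{j+1}(0)$ for $1\le j\le N-1$; * $W(0)$ has modified deficiency margin $c>0$ with respect to $\Sigma_0$: with $\Sigma=W(0)W(0)^\top$,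 $\ \min_{U\in\mathcal{O}(n)}\|\Sigma^{1/2}-\Sigma_0^{1/2}U\|_F\le\sigma_{\min}(\Sigma_0^{1/2})-c$; * the step size satisfies $$0<\eta\le\min\left\{\frac{c^2}{8M\sqrt{L^1(W(0))}},\ \frac{N c^{\frac{2(N-1)}{N}}}{2\Delta},\ \frac{1}{4Nc^{\frac{2(N-1)}{N}}}\right\},$$ where the first term is read as $+\infty$ if $L^1(W(0))=0$, and $$M=\sqrt{2\big(L^1(W(0))+\|\Sigma_0^{1/2}\|_F^2\big)},$$ $$\Delta=\frac{2^{N+1}}{c^{2N}}N^2M^{\frac{4N-3}{N}}\lambda_{\max}^{1/2}(\Sigma_0)+8N(N-1)M^{\frac{3N-4}{N}}\Big(M^{\frac1N}+\|\Sigma_0^{1/2}\|_F\Big).$$ Then $L^N$ is differentiable at every iterate $\overrightarrow{W}(k)$ (so the iteration is well defined), and for every $\epsilon>0$ one has $L^N(\overrightarrow{W}(k))\le\epsilon$ for every integer $k\ge 0$ with $$k\ge\frac{1}{2\eta N c^{\frac{2(N-1)}{N}}}\log\left(\frac{L^1(W(0))}{\epsilon}\right)$$ (if $L^1(W(0))=0$,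 for every $k\ge 0$). -/

import Mathlib

open scoped Matrix MatrixOrder

/-- The space of weight tuples `(W_1, …, W_N)` of a linear network with `N` layers and widths
`d 0, …, d N`. Layers are indexed from `0`, so the component `j` is the weight matrix `W_{j+1}`. -/
abbrev Params (N : ℕ) (d : ℕ → ℕ) : Type :=
  (j : Fin N) → Matrix (Fin (d (j + 1))) (Fin (d j)) ℝ

/-- The product `W_k ⋯ W_1` of the first `k` layers. -/
def partialProd {N : ℕ} {d : ℕ → ℕ} (W : Params N d) :
    (k : ℕ) → k ≤ N → Matrix (Fin (d k)) (Fin (d 0)) ℝ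
  | 0, _ => 1
  | k + 1, hk => W ⟨k, hk⟩ * partialProd W k (Nat.le_of_succ_le hk)

/-- The end-to-end matrix `W_N ⋯ W_1`. -/
def endToEnd {N : ℕ} {d : ℕ → ℕ} (W : Params N d) : Matrix (Fin (d N)) (Fin (d 0)) ℝ :=
  partialProd W N le_rfl

/-- Balanced weights: `W_j W_jᵀ = W_{j+1}ᵀ W_{j+1}` for any two consecutive layers. -/
def BalancedWeights {N : ℕ} {d : ℕ → ℕ} (W : Params N d) : Prop :=
  ∀ (j : ℕ) (hj : j + 1 < N),
    W ⟨j, Nat.lt_of_succ_lt hj⟩ * (W ⟨j, Nat.lt_of_succ_lt hj⟩)ᵀ =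
      (W ⟨j + 1, hj⟩)ᵀ * W ⟨j + 1, hj⟩

noncomputable section

/-- The squared Bures-Wasserstein distance
`tr (Σ + Σ₀ - 2 (Σ₀^{1/2} Σ Σ₀^{1/2})^{1/2})` of positive semidefinite matrices. -/
def buresSq {n : ℕ} (S S₀ : Matrix (Fin n) (Fin n) ℝ) : ℝ :=
  Matrix.trace (S + S₀ - (2 : ℝ) • CFC.sqrt (CFC.sqrt S₀ * S * CFC.sqrt S₀))

/-- The loss in function space, `L¹(W) = B²(W Wᵀ, Σ₀)`. -/
def lossOne {n m : ℕ} (S₀ : Matrix (Fin n) (Fin n) ℝ) (W : Matrix (Fin n) (Fin m) ℝ) : ℝ :=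
  buresSq (W * Wᵀ) S₀

/-- The loss in parameter space, `L^N(W_1, …, W_N) = L¹(W_N ⋯ W_1)`. -/
def lossN {N : ℕ} {d : ℕ → ℕ} (S₀ : Matrix (Fin (d N)) (Fin (d N)) ℝ) (W : Params N d) : ℝ :=
  lossOne S₀ (endToEnd W)

/-- The gradient of `L^N` for the scalar product `∑ⱼ tr (Aⱼᵀ Bⱼ)`: the entry `(a, b)` of its
component `j` is the derivative of `L^N` in the direction of the matrix unit `E_{ab}` in layer
`j`. (It is meaningful where `L^N` is differentiable.) -/
def gradLossN {N : ℕ} {d : ℕ → ℕ} (S₀ : Matrix (Fin (d N)) (Fin (d N)) ℝ) (W : Params N d) :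
    Params N d :=
  fun j => Matrix.of fun a b =>
    fderiv ℝ (lossN S₀ : Params N d → ℝ) W (Pi.single j (Matrix.single a b (1 : ℝ)))

/-- `W 0, W 1, …` are the iterates of gradient descent on `L^N` with step size `η`. -/
def IsGradientDescent {N : ℕ} {d : ℕ → ℕ} (S₀ : Matrix (Fin (d N)) (Fin (d N)) ℝ) (η : ℝ)
    (W : ℕ → Params N d) : Prop :=
  ∀ k, W (k + 1) = W k - η • gradLossN S₀ (W k)

/-- The Frobenius norm `(tr (Aᵀ A))^{1/2}`. -/
def frobNorm {n m : ℕ} (A : Matrix (Fin n) (Fin m) ℝ) : ℝ :=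
  Real.sqrt (Matrix.trace (Aᵀ * A))

/-- The smallest singular value of a square matrix of size `n ≥ 1`. (Mathlib lists the singular
values in decreasing order, starting from the index `0`.) -/
def sigmaMin {n : ℕ} (A : Matrix (Fin n) (Fin n) ℝ) : ℝ :=
  (Matrix.toEuclideanLin A).singularValues (n - 1)

/-- The largest eigenvalue of a symmetric matrix of size `n ≥ 1`. -/
def lambdaMax {n : ℕ} (A : Matrix (Fin n) (Fin n) ℝ) : ℝ :=
  sSup (spectrum ℝ A)

/-- `Σ` has modified deficiency margin `c` with respect to `Σ₀`:
`min_{U ∈ O(n)} ‖Σ^{1/2} - Σ₀^{1/2} U‖_F ≤ σ_min(Σ₀^{1/2}) - c`. -/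
def HasModifiedDeficiencyMargin {n : ℕ} (S₀ S : Matrix (Fin n) (Fin n) ℝ) (c : ℝ) : Prop :=
  (⨅ U : Matrix.orthogonalGroup (Fin n) ℝ,
      frobNorm (CFC.sqrt S - CFC.sqrt S₀ * (U : Matrix (Fin n) (Fin n) ℝ))) ≤
    sigmaMin (CFC.sqrt S₀) - c

/-- `M = (2 (L¹(W) + ‖Σ₀^{1/2}‖_F²))^{1/2}`. -/
def boundM {n m : ℕ} (S₀ : Matrix (Fin n) (Fin n) ℝ) (W : Matrix (Fin n) (Fin m) ℝ) : ℝ :=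
  Real.sqrt (2 * (lossOne S₀ W + frobNorm (CFC.sqrt S₀) ^ 2))

/-- `Δ = 2^{N+1} / c^{2N} · N² M^{(4N-3)/N} λ_max(Σ₀)^{1/2}
  + 8 N (N-1) M^{(3N-4)/N} (M^{1/N} + ‖Σ₀^{1/2}‖_F)`. -/
def boundDelta {n : ℕ} (N : ℕ) (c M : ℝ) (S₀ : Matrix (Fin n) (Fin n) ℝ) : ℝ :=
  2 ^ (N + 1) / c ^ (2 * N) * (N : ℝ) ^ 2 * M ^ ((4 * (N : ℝ) - 3) / N) *
      Real.sqrt (lambdaMax S₀) +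
    8 * (N : ℝ) * ((N : ℝ) - 1) * M ^ ((3 * (N : ℝ) - 4) / N) *
      (M ^ (1 / (N : ℝ)) + frobNorm (CFC.sqrt S₀))

end

/-!
`L¹(X)` is the squared Frobenius distance from `X` to the set of matrices `Y` with `Y Yᵀ = Σ₀`.
At a matrix `X` of full row rank it is squeezed between two quadratics that agree to first order,
so its gradient there is `2 (X - Y)` for the nearest such `Y`.

Balanced weights with an end-to-end matrix of full row rank are isometric images of `N` copies of
one square matrix, and gradient descent keeps the iterates isometric images of square matrices
`w_0, …, w_{N-1}`. On those, a step is a gradient step on `‖w_{N-1} ⋯ w_0 - Y‖²` with `Y` frozen at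
the nearest point of the current product, and moving `Y` afterwards only lowers the loss.

The differences `w_{j+1}ᵀ w_{j+1} - w_j w_jᵀ`, which vanish initially and are conserved by the
gradient flow, change by only `O(η²)` in a step: by at most `2 η²` times the squared norm of the
gradient. This telescopes against the decrease of the loss, so they stay small. Layers with small
imbalance have singular values close to the `N`-th roots of those of the product, and these are
bounded below by the deficiency margin and above by the loss. The lower bound yields a
Polyak-Łojasiewicz inequality, the upper bound controls the Taylor remainder of a step, and together
they give linear convergence.
-/

section Frobenius

variable {n m : ℕ}

lemma trace_transpose_mul_eq_sum (A B : Matrix (Fin n) (Fin m) ℝ) :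
    (Aᵀ * B).trace = ∑ j, ∑ i, A i j * B i j := rfl

lemma trace_transpose_mul_self_nonneg (A : Matrix (Fin n) (Fin m) ℝ) : 0 ≤ (Aᵀ * A).trace := by
  simpa using (Matrix.posSemidef_conjTranspose_mul_self A).trace_nonneg

lemma trace_transpose_mul_comm (A B : Matrix (Fin n) (Fin m) ℝ) :
    (Aᵀ * B).trace = (Bᵀ * A).trace := by
  rw [← Matrix.trace_transpose, Matrix.transpose_mul, Matrix.transpose_transpose]

lemma frobNorm_nonneg (A : Matrix (Fin n) (Fin m) ℝ) : 0 ≤ frobNorm A := Real.sqrt_nonneg _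

lemma frobNorm_sq (A : Matrix (Fin n) (Fin m) ℝ) : frobNorm A ^ 2 = (Aᵀ * A).trace :=
  Real.sq_sqrt (trace_transpose_mul_self_nonneg A)

lemma frobNorm_sq_eq_trace_mul_transpose (A : Matrix (Fin n) (Fin m) ℝ) :
    frobNorm A ^ 2 = (A * Aᵀ).trace := by
  rw [frobNorm_sq, Matrix.trace_mul_comm]

section

open scoped Matrix.Norms.Frobenius

lemma frobNorm_eq_norm (A : Matrix (Fin n) (Fin m) ℝ) : frobNorm A = ‖A‖ := by
  rw [frobNorm, trace_transpose_mul_eq_sum, Matrix.frobenius_norm_def, Real.sqrt_eq_rpow,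
    Finset.sum_comm]
  simp [sq]

lemma frobNorm_add_le (A B : Matrix (Fin n) (Fin m) ℝ) :
    frobNorm (A + B) ≤ frobNorm A + frobNorm B := by
  simpa only [frobNorm_eq_norm] using norm_add_le A B

lemma frobNorm_neg (A : Matrix (Fin n) (Fin m) ℝ) : frobNorm (-A) = frobNorm A := by
  simp only [frobNorm_eq_norm, norm_neg]

lemma frobNorm_sub_comm (A B : Matrix (Fin n) (Fin m) ℝ) :
    frobNorm (A - B) = frobNorm (B - A) := by
  simp only [frobNorm_eq_norm, norm_sub_rev A B]

lemma frobNorm_zero : frobNorm (0 : Matrix (Fin n) (Fin m) ℝ) = 0 := by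
  simp only [frobNorm_eq_norm, norm_zero]

lemma frobNorm_smul (a : ℝ) (A : Matrix (Fin n) (Fin m) ℝ) :
    frobNorm (a • A) = |a| * frobNorm A := by
  simp only [frobNorm_eq_norm, norm_smul, Real.norm_eq_abs]

lemma frobNorm_transpose (A : Matrix (Fin n) (Fin m) ℝ) : frobNorm Aᵀ = frobNorm A := by
  simp only [frobNorm_eq_norm, Matrix.frobenius_norm_transpose]

lemma norm_toLp_mulVec_le_frobNorm (A : Matrix (Fin n) (Fin m) ℝ) (v : Fin m → ℝ) :
    ‖WithLp.toLp 2 (A *ᵥ v)‖ ≤ frobNorm A * ‖WithLp.toLp 2 v‖ := by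
  rw [← Matrix.frobenius_norm_replicateCol (ι := Unit) v,
    ← Matrix.frobenius_norm_replicateCol (ι := Unit) (A *ᵥ v), Matrix.replicateCol_mulVec,
    frobNorm_eq_norm]
  exact Matrix.frobenius_norm_mul _ _

end

lemma frobNorm_add_sq (A B : Matrix (Fin n) (Fin m) ℝ) :
    frobNorm (A + B) ^ 2 = frobNorm A ^ 2 + 2 * (Aᵀ * B).trace + frobNorm B ^ 2 := by
  simp only [frobNorm_sq, Matrix.transpose_add, Matrix.add_mul, Matrix.mul_add, Matrix.trace_add]
  rw [trace_transpose_mul_comm B A]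
  ring

lemma frobNorm_sub_sq (A B : Matrix (Fin n) (Fin m) ℝ) :
    frobNorm (A - B) ^ 2 = frobNorm A ^ 2 - 2 * (Aᵀ * B).trace + frobNorm B ^ 2 := by
  rw [sub_eq_add_neg, frobNorm_add_sq, frobNorm_neg, Matrix.mul_neg, Matrix.trace_neg]
  ring

lemma trace_transpose_mul_le (A B : Matrix (Fin n) (Fin m) ℝ) :
    (Aᵀ * B).trace ≤ frobNorm A * frobNorm B := by
  have h := pow_le_pow_left₀ (frobNorm_nonneg _) (frobNorm_add_le A B) 2
  rw [frobNorm_add_sq] at h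
  linarith

end Frobenius

section

open scoped Matrix.Norms.L2Operator

section OperatorNorm

variable {n m : ℕ}

lemma norm_le_frobNorm (A : Matrix (Fin n) (Fin m) ℝ) : ‖A‖ ≤ frobNorm A := by
  rw [Matrix.l2_opNorm_def]
  exact ContinuousLinearMap.opNorm_le_bound _ (frobNorm_nonneg A) fun v =>
    norm_toLp_mulVec_le_frobNorm A v.ofLp

lemma norm_transpose {ι κ : Type*} [Fintype ι] [DecidableEq ι] [Fintype κ] [DecidableEq κ]
    (A : Matrix ι κ ℝ) : ‖Aᵀ‖ = ‖A‖ := by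
  rw [← Matrix.conjTranspose_eq_transpose_of_trivial, Matrix.l2_opNorm_conjTranspose]

lemma norm_one_matrix_le {ι : Type*} [Fintype ι] [DecidableEq ι] :
    ‖(1 : Matrix ι ι ℝ)‖ ≤ 1 := by
  rcases subsingleton_or_nontrivial (Matrix ι ι ℝ) with h | h
  · simp [Subsingleton.elim (1 : Matrix ι ι ℝ) 0]
  · exact CStarRing.norm_one.le

end OperatorNorm

section LoewnerOrder

variable {ι κ : Type*}

lemma trace_le_of_le [Fintype ι] {A B : Matrix ι ι ℝ} (h : A ≤ B) : A.trace ≤ B.trace := by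
  rw [← sub_nonneg, ← Matrix.trace_sub]
  exact (Matrix.le_iff.1 h).trace_nonneg

lemma transpose_mul_mul_le [Fintype ι] [Finite κ] {A B : Matrix ι ι ℝ} (h : A ≤ B)
    (Z : Matrix ι κ ℝ) : Zᵀ * A * Z ≤ Zᵀ * B * Z := by
  rw [Matrix.le_iff, ← Matrix.sub_mul, ← Matrix.mul_sub]
  simpa using (Matrix.le_iff.1 h).conjTranspose_mul_mul_same Z

lemma isSelfAdjoint_of_transpose_eq {A : Matrix ι ι ℝ} (hA : Aᵀ = A) : IsSelfAdjoint A := by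
  rwa [IsSelfAdjoint, Matrix.star_eq_conjTranspose, Matrix.conjTranspose_eq_transpose_of_trivial]

lemma posDef_of_smul_one_le [DecidableEq ι] {A : Matrix ι ι ℝ} {s : ℝ} (hs : 0 < s)
    (h : s • 1 ≤ A) : A.PosDef := by
  simpa using (Matrix.PosDef.one.smul hs).add_posSemidef (Matrix.le_iff.1 h)

variable [Fintype ι] [DecidableEq ι]

lemma le_norm_smul_one {A : Matrix ι ι ℝ} (hA : Aᵀ = A) : A ≤ ‖A‖ • 1 := by
  rw [← Algebra.algebraMap_eq_smul_one,
    le_algebraMap_iff_spectrum_le (isSelfAdjoint_of_transpose_eq hA)]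
  intro x hx
  calc x ≤ ‖x‖ := Real.le_norm_self x
    _ ≤ ‖A‖ * ‖(1 : Matrix ι ι ℝ)‖ := spectrum.norm_le_norm_mul_of_mem hx
    _ ≤ ‖A‖ := mul_le_of_le_one_right (norm_nonneg _) norm_one_matrix_le

lemma neg_norm_smul_one_le {A : Matrix ι ι ℝ} (hA : Aᵀ = A) : -(‖A‖ • 1) ≤ A := by
  have := le_norm_smul_one (A := -A) (by simp [hA])
  rw [norm_neg] at this
  exact neg_le.1 this

lemma transpose_mul_self_le_norm_sq_smul_one [Fintype κ] (A : Matrix κ ι ℝ) :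
    Aᵀ * A ≤ ‖A‖ ^ 2 • 1 := by
  have h := le_norm_smul_one (A := Aᵀ * A) (by simp)
  rwa [← Matrix.conjTranspose_eq_transpose_of_trivial A, Matrix.l2_opNorm_conjTranspose_mul_self,
    ← sq] at h

lemma smul_one_le_of_le_pow {A : Matrix ι ι ℝ} (hA : 0 ≤ A) {N : ℕ} (hN : N ≠ 0) {b : ℝ}
    (h : b ^ N • (1 : Matrix ι ι ℝ) ≤ A ^ N) : b • (1 : Matrix ι ι ℝ) ≤ A := by
  have hAs : IsSelfAdjoint A := .of_nonneg hA
  rw [← Algebra.algebraMap_eq_smul_one, algebraMap_le_iff_le_spectrum hAs]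
  rw [← Algebra.algebraMap_eq_smul_one, algebraMap_le_iff_le_spectrum (hAs.pow N)] at h
  exact fun x hx => le_of_pow_le_pow_left₀ hN (spectrum_nonneg_of_nonneg hA hx)
    (h _ (spectrum.pow_mem_pow A N hx))

lemma smul_one_le_mul_transpose {A : Matrix ι ι ℝ} {s : ℝ} (hs : 0 < s)
    (h : s • 1 ≤ Aᵀ * A) : s • 1 ≤ A * Aᵀ := by
  have hA : IsUnit A := by
    have hdet := (Matrix.isUnit_iff_isUnit_det _).1 (posDef_of_smul_one_le hs h).isUnit
    rw [Matrix.det_mul] at hdet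
    exact (Matrix.isUnit_iff_isUnit_det A).2 (isUnit_of_mul_isUnit_right hdet)
  rw [← Algebra.algebraMap_eq_smul_one,
    algebraMap_le_iff_le_spectrum (isSelfAdjoint_of_transpose_eq (by simp))] at h ⊢
  intro x hx
  have hx0 : x ≠ 0 := by
    rintro rfl
    exact spectrum.zero_mem_iff ℝ |>.1 hx (hA.mul ((Matrix.isUnit_transpose A).2 hA))
  have hmem : x ∈ spectrum ℝ (A * Aᵀ) \ {0} := ⟨hx, hx0⟩
  rw [spectrum.nonzero_mul_comm] at hmem
  exact h x hmem.1

end LoewnerOrder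

section FrobeniusProducts

variable {n m p : ℕ}

lemma frobNorm_mul_le (A : Matrix (Fin n) (Fin m) ℝ) (B : Matrix (Fin m) (Fin p) ℝ) :
    frobNorm (A * B) ≤ ‖A‖ * frobNorm B := by
  refine le_of_sq_le_sq ?_ (mul_nonneg (norm_nonneg _) (frobNorm_nonneg _))
  rw [mul_pow, frobNorm_sq, frobNorm_sq]
  simpa [Matrix.mul_assoc] using
    trace_le_of_le (transpose_mul_mul_le (transpose_mul_self_le_norm_sq_smul_one A) B)

lemma frobNorm_mul_le_mul_norm (A : Matrix (Fin n) (Fin m) ℝ) (B : Matrix (Fin m) (Fin p) ℝ) :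
    frobNorm (A * B) ≤ frobNorm A * ‖B‖ := by
  rw [← frobNorm_transpose, Matrix.transpose_mul, mul_comm, ← frobNorm_transpose A,
    ← norm_transpose B]
  exact frobNorm_mul_le _ _

lemma mul_frobNorm_sq_le {A : Matrix (Fin n) (Fin m) ℝ} {s : ℝ} (h : s • 1 ≤ Aᵀ * A)
    (Z : Matrix (Fin m) (Fin p) ℝ) : s * frobNorm Z ^ 2 ≤ frobNorm (A * Z) ^ 2 := by
  rw [frobNorm_sq, frobNorm_sq]
  simpa [Matrix.mul_assoc] using trace_le_of_le (transpose_mul_mul_le h Z)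

end FrobeniusProducts

section SquareRoot

variable {ι κ : Type*}

lemma transpose_eq_of_posSemidef {A : Matrix ι ι ℝ} (hA : A.PosSemidef) : Aᵀ = A := by
  rw [← Matrix.conjTranspose_eq_transpose_of_trivial]
  exact hA.isHermitian

lemma posSemidef_mul_transpose [Finite ι] [Fintype κ] (A : Matrix ι κ ℝ) : (A * Aᵀ).PosSemidef := by
  simpa using Matrix.posSemidef_self_mul_conjTranspose A

variable [Fintype ι]

open scoped Classical in
lemma posSemidef_sqrt (A : Matrix ι ι ℝ) : (CFC.sqrt A).PosSemidef :=
  Matrix.nonneg_iff_posSemidef.1 (CFC.sqrt_nonneg A)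

open scoped Classical in
lemma posDef_sqrt {A : Matrix ι ι ℝ} (hA : A.PosDef) : (CFC.sqrt A).PosDef :=
  Matrix.isStrictlyPositive_iff_posDef.1 (IsStrictlyPositive.sqrt A hA.isStrictlyPositive)

open scoped Classical in
lemma transpose_sqrt (A : Matrix ι ι ℝ) : (CFC.sqrt A)ᵀ = CFC.sqrt A :=
  transpose_eq_of_posSemidef (posSemidef_sqrt A)

open scoped Classical in
lemma sqrt_mul_sqrt {A : Matrix ι ι ℝ} (hA : A.PosSemidef) : CFC.sqrt A * CFC.sqrt A = A :=
  CFC.sqrt_mul_sqrt_self A hA.nonneg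

lemma isUnit_det_of_posDef [DecidableEq ι] {A : Matrix ι ι ℝ} (hA : A.PosDef) : IsUnit A.det :=
  (Matrix.isUnit_iff_isUnit_det A).1 hA.isUnit

lemma trace_mul_nonneg {A B : Matrix ι ι ℝ} (hA : A.PosSemidef) (hB : B.PosSemidef) :
    0 ≤ (A * B).trace := by
  classical
  have h := (hA.conjTranspose_mul_mul_same (CFC.sqrt B)).trace_nonneg
  rwa [Matrix.conjTranspose_eq_transpose_of_trivial, transpose_sqrt, Matrix.mul_assoc,
    Matrix.trace_mul_comm, Matrix.mul_assoc, sqrt_mul_sqrt hB] at h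

end SquareRoot

section NuclearNorm

variable {ι κ : Type*} [Fintype ι] [DecidableEq ι] [Fintype κ]

/-- The partial isometry `P = (A Aᵀ)^{-1/2} A` of the left polar decomposition
`A = (A Aᵀ)^{1/2} P`. It is meaningful when the rows of `A` are linearly independent, which is
expressed by `(A * Aᵀ).PosDef`. -/
noncomputable def polarFactor (A : Matrix ι κ ℝ) : Matrix ι κ ℝ := (CFC.sqrt (A * Aᵀ))⁻¹ * A

variable {A : Matrix ι κ ℝ}

lemma transpose_inv_sqrt (B : Matrix ι ι ℝ) : ((CFC.sqrt B)⁻¹)ᵀ = (CFC.sqrt B)⁻¹ := by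
  rw [Matrix.transpose_nonsing_inv, transpose_sqrt]

lemma inv_sqrt_mul_mul_transpose (hA : (A * Aᵀ).PosDef) :
    (CFC.sqrt (A * Aᵀ))⁻¹ * (A * Aᵀ) = CFC.sqrt (A * Aᵀ) := by
  conv_lhs => rw [← sqrt_mul_sqrt hA.posSemidef, ← Matrix.mul_assoc]
  rw [sqrt_mul_sqrt hA.posSemidef,
    Matrix.nonsing_inv_mul _ (isUnit_det_of_posDef (posDef_sqrt hA)), Matrix.one_mul]

lemma polarFactor_mul_transpose (hA : (A * Aᵀ).PosDef) :
    polarFactor A * (polarFactor A)ᵀ = 1 := by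
  rw [polarFactor, Matrix.transpose_mul, transpose_inv_sqrt, Matrix.mul_assoc,
    ← Matrix.mul_assoc A, ← Matrix.mul_assoc, inv_sqrt_mul_mul_transpose hA,
    Matrix.mul_nonsing_inv _ (isUnit_det_of_posDef (posDef_sqrt hA))]

lemma polarFactor_mul_transpose_of_isometry {μ : Type*} [Fintype μ] [DecidableEq κ]
    {U : Matrix μ κ ℝ} (hU : Uᵀ * U = 1) (A : Matrix ι κ ℝ) :
    polarFactor (A * Uᵀ) = polarFactor A * Uᵀ := by
  rw [polarFactor, polarFactor, Matrix.transpose_mul, Matrix.transpose_transpose,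
    Matrix.mul_assoc A, ← Matrix.mul_assoc Uᵀ, hU, Matrix.one_mul, Matrix.mul_assoc]

lemma trace_transpose_mul_polarFactor (hA : (A * Aᵀ).PosDef) :
    (Aᵀ * polarFactor A).trace = (CFC.sqrt (A * Aᵀ)).trace := by
  rw [Matrix.trace_mul_comm, polarFactor, Matrix.mul_assoc, inv_sqrt_mul_mul_transpose hA]

lemma two_mul_trace_mul_transpose_le (A Q : Matrix ι κ ℝ) {T : Matrix ι ι ℝ} (hT : T.PosDef) :
    2 * (A * Qᵀ).trace ≤ (T * (A * Aᵀ)).trace + (T⁻¹ * (Q * Qᵀ)).trace := by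
  have hTT := Matrix.mul_nonsing_inv T (isUnit_det_of_posDef hT)
  have hTi := transpose_eq_of_posSemidef hT.inv.posSemidef
  have h := trace_mul_nonneg hT.posSemidef (posSemidef_mul_transpose (A - T⁻¹ * Q))
  have hexpand : T * ((A - T⁻¹ * Q) * (A - T⁻¹ * Q)ᵀ) =
      T * (A * Aᵀ) - Q * Aᵀ - (T * (A * Qᵀ) * T⁻¹ - Q * Qᵀ * T⁻¹) := by
    simp only [Matrix.transpose_sub, Matrix.transpose_mul, hTi, Matrix.sub_mul, Matrix.mul_sub,
      ← Matrix.mul_assoc, hTT, Matrix.one_mul]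
  have hcross : (T * (A * Qᵀ) * T⁻¹).trace = (A * Qᵀ).trace := by
    rw [Matrix.trace_mul_comm, ← Matrix.mul_assoc,
      Matrix.nonsing_inv_mul T (isUnit_det_of_posDef hT), Matrix.one_mul]
  have hsymm : (Q * Aᵀ).trace = (A * Qᵀ).trace := by
    rw [← Matrix.trace_transpose, Matrix.transpose_mul, Matrix.transpose_transpose]
  rw [hexpand, Matrix.trace_sub, Matrix.trace_sub, Matrix.trace_sub, hcross, hsymm,
    Matrix.trace_mul_comm (Q * Qᵀ)] at h
  linarith

lemma two_mul_trace_sqrt_le {P T : Matrix ι ι ℝ} (hP : P.PosSemidef) (hT : T.PosDef) :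
    2 * (CFC.sqrt P).trace ≤ (T * P).trace + T⁻¹.trace := by
  have h := two_mul_trace_mul_transpose_le (CFC.sqrt P) 1 hT
  rw [transpose_sqrt, sqrt_mul_sqrt hP] at h
  simpa using h

lemma trace_mul_transpose_le_trace_sqrt (A : Matrix ι κ ℝ) {Q : Matrix ι κ ℝ} (hQ : Q * Qᵀ = 1) :
    (A * Qᵀ).trace ≤ (CFC.sqrt (A * Aᵀ)).trace := by
  set R := CFC.sqrt (A * Aᵀ)
  have hR : R.PosSemidef := posSemidef_sqrt _
  have hRR : R * R = A * Aᵀ := sqrt_mul_sqrt (posSemidef_mul_transpose A)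
  -- `R` may be singular, so Young's inequality is applied with the weight `(R + ε)⁻¹`.
  have hreg (ε : ℝ) (hε : 0 < ε) :
      (A * Qᵀ).trace ≤ R.trace + ε * (Fintype.card ι / 2) := by
    set T := R + ε • (1 : Matrix ι ι ℝ) with hTdef
    have hT : T.PosDef := (Matrix.PosDef.one.smul hε).posSemidef_add hR
    have hyoung := two_mul_trace_mul_transpose_le A Q hT.inv
    rw [hQ, Matrix.mul_one, Matrix.nonsing_inv_nonsing_inv _ (isUnit_det_of_posDef hT), ← hRR]
      at hyoung
    have hTRR : T⁻¹ * (R * R) = R - ε • (T⁻¹ * R) := by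
      have hRR' : R * R = T * R - ε • R := by simp [hTdef, Matrix.add_mul]
      rw [hRR', Matrix.mul_sub, ← Matrix.mul_assoc,
        Matrix.nonsing_inv_mul _ (isUnit_det_of_posDef hT), Matrix.one_mul, Matrix.mul_smul]
    have hTR := mul_nonneg hε.le (trace_mul_nonneg hT.inv.posSemidef hR)
    rw [hTRR, hTdef, ← hTdef, Matrix.trace_sub, Matrix.trace_smul, smul_eq_mul, Matrix.trace_add,
      Matrix.trace_smul, Matrix.trace_one, smul_eq_mul] at hyoung
    linarith
  refine le_of_forall_pos_le_add fun ε hε => ?_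
  refine (hreg (ε / (Fintype.card ι + 1)) (by positivity)).trans ?_
  gcongr
  rw [div_mul_div_comm, div_le_iff₀ (by positivity)]
  nlinarith [(Nat.cast_nonneg (Fintype.card ι) : (0 : ℝ) ≤ _)]

lemma two_mul_trace_sqrt_add_le (hA : (A * Aᵀ).PosDef) (H : Matrix ι κ ℝ) :
    2 * (CFC.sqrt ((A + H) * (A + H)ᵀ)).trace ≤ 2 * (CFC.sqrt (A * Aᵀ)).trace +
      2 * (Hᵀ * polarFactor A).trace + ((CFC.sqrt (A * Aᵀ))⁻¹ * (H * Hᵀ)).trace := by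
  have hR := posDef_sqrt hA
  have h := two_mul_trace_sqrt_le (posSemidef_mul_transpose (A + H)) hR.inv
  have hleft : ((CFC.sqrt (A * Aᵀ))⁻¹ * (A * Hᵀ)).trace = (Hᵀ * polarFactor A).trace := by
    rw [Matrix.trace_mul_comm Hᵀ, polarFactor, Matrix.mul_assoc]
  have hright : ((CFC.sqrt (A * Aᵀ))⁻¹ * (H * Aᵀ)).trace = (Hᵀ * polarFactor A).trace := by
    rw [← hleft, ← Matrix.trace_transpose, Matrix.transpose_mul, Matrix.transpose_mul,
      Matrix.transpose_transpose, transpose_inv_sqrt, Matrix.trace_mul_comm]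
  simp only [Matrix.nonsing_inv_nonsing_inv _ (isUnit_det_of_posDef hR), Matrix.transpose_add,
    Matrix.add_mul, Matrix.mul_add, Matrix.trace_add, hleft, hright,
    inv_sqrt_mul_mul_transpose hA] at h
  simp only [Matrix.transpose_add, Matrix.add_mul, Matrix.mul_add]
  linarith

end NuclearNorm

section Loss

variable {n m : ℕ} {S₀ : Matrix (Fin n) (Fin n) ℝ}

lemma lossOne_eq (S₀ : Matrix (Fin n) (Fin n) ℝ) (X : Matrix (Fin n) (Fin m) ℝ) :
    lossOne S₀ X = frobNorm X ^ 2 + S₀.trace -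
      2 * (CFC.sqrt (CFC.sqrt S₀ * X * (CFC.sqrt S₀ * X)ᵀ)).trace := by
  rw [lossOne, buresSq, Matrix.trace_sub, Matrix.trace_add, Matrix.trace_smul, smul_eq_mul,
    Matrix.transpose_mul, transpose_sqrt, frobNorm_sq_eq_trace_mul_transpose]
  simp only [Matrix.mul_assoc]

lemma sqrt_mul_mul_transpose_self (hS₀ : S₀.PosSemidef) {Q : Matrix (Fin n) (Fin m) ℝ}
    (hQ : Q * Qᵀ = 1) : CFC.sqrt S₀ * Q * (CFC.sqrt S₀ * Q)ᵀ = S₀ := by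
  rw [Matrix.transpose_mul, transpose_sqrt, Matrix.mul_assoc, ← Matrix.mul_assoc Q, hQ,
    Matrix.one_mul, sqrt_mul_sqrt hS₀]

lemma frobNorm_sqrt_mul_sq (hS₀ : S₀.PosSemidef) {Q : Matrix (Fin n) (Fin m) ℝ}
    (hQ : Q * Qᵀ = 1) : frobNorm (CFC.sqrt S₀ * Q) ^ 2 = S₀.trace := by
  rw [frobNorm_sq_eq_trace_mul_transpose, sqrt_mul_mul_transpose_self hS₀ hQ]

lemma trace_transpose_mul_sqrt_mul (X Q : Matrix (Fin n) (Fin m) ℝ) :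
    (Xᵀ * (CFC.sqrt S₀ * Q)).trace = ((CFC.sqrt S₀ * X)ᵀ * Q).trace := by
  rw [Matrix.transpose_mul, transpose_sqrt, Matrix.mul_assoc]

lemma lossOne_le_frobNorm_sub_sq (hS₀ : S₀.PosSemidef) (X : Matrix (Fin n) (Fin m) ℝ)
    {Q : Matrix (Fin n) (Fin m) ℝ} (hQ : Q * Qᵀ = 1) :
    lossOne S₀ X ≤ frobNorm (X - CFC.sqrt S₀ * Q) ^ 2 := by
  have h := trace_mul_transpose_le_trace_sqrt (CFC.sqrt S₀ * X) hQ
  rw [Matrix.trace_mul_comm, trace_transpose_mul_comm Q] at h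
  rw [lossOne_eq, frobNorm_sub_sq, frobNorm_sqrt_mul_sq hS₀ hQ, trace_transpose_mul_sqrt_mul]
  linarith

/-- The matrix `Y` nearest to `X` in the Frobenius norm among those with `Y * Yᵀ = S₀`, for
positive definite `S₀` and `X * Xᵀ`. -/
noncomputable def nearestRoot (S₀ : Matrix (Fin n) (Fin n) ℝ) (X : Matrix (Fin n) (Fin m) ℝ) :
    Matrix (Fin n) (Fin m) ℝ :=
  CFC.sqrt S₀ * polarFactor (CFC.sqrt S₀ * X)

lemma nearestRoot_mul_transpose_of_isometry {U : Matrix (Fin m) (Fin n) ℝ} (hU : Uᵀ * U = 1)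
    (S₀ X : Matrix (Fin n) (Fin n) ℝ) : nearestRoot S₀ (X * Uᵀ) = nearestRoot S₀ X * Uᵀ := by
  rw [nearestRoot, nearestRoot, ← Matrix.mul_assoc, polarFactor_mul_transpose_of_isometry hU,
    Matrix.mul_assoc]

variable {X : Matrix (Fin n) (Fin m) ℝ}

lemma posDef_sqrt_mul_mul_transpose (hS₀ : S₀.PosDef) (hX : (X * Xᵀ).PosDef) :
    (CFC.sqrt S₀ * X * (CFC.sqrt S₀ * X)ᵀ).PosDef := by
  have h := hX.mul_mul_conjTranspose_same (B := CFC.sqrt S₀)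
    (Matrix.vecMul_injective_iff_isUnit.2 (posDef_sqrt hS₀).isUnit)
  simpa [Matrix.transpose_mul, Matrix.mul_assoc] using h

lemma nearestRoot_mul_transpose_self (hS₀ : S₀.PosDef) (hX : (X * Xᵀ).PosDef) :
    nearestRoot S₀ X * (nearestRoot S₀ X)ᵀ = S₀ :=
  sqrt_mul_mul_transpose_self hS₀.posSemidef
    (polarFactor_mul_transpose (posDef_sqrt_mul_mul_transpose hS₀ hX))

lemma frobNorm_nearestRoot (hS₀ : S₀.PosDef) (hX : (X * Xᵀ).PosDef) :
    frobNorm (nearestRoot S₀ X) ^ 2 = S₀.trace :=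
  frobNorm_sqrt_mul_sq hS₀.posSemidef
    (polarFactor_mul_transpose (posDef_sqrt_mul_mul_transpose hS₀ hX))

lemma lossOne_eq_frobNorm_sub_nearestRoot_sq (hS₀ : S₀.PosDef) (hX : (X * Xᵀ).PosDef) :
    lossOne S₀ X = frobNorm (X - nearestRoot S₀ X) ^ 2 := by
  rw [lossOne_eq, frobNorm_sub_sq, frobNorm_nearestRoot hS₀ hX, nearestRoot,
    trace_transpose_mul_sqrt_mul,
    trace_transpose_mul_polarFactor (posDef_sqrt_mul_mul_transpose hS₀ hX)]
  ring

lemma lossOne_le_frobNorm_sub_nearestRoot_sq (hS₀ : S₀.PosDef) (hX : (X * Xᵀ).PosDef)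
    (Z : Matrix (Fin n) (Fin m) ℝ) : lossOne S₀ Z ≤ frobNorm (Z - nearestRoot S₀ X) ^ 2 :=
  lossOne_le_frobNorm_sub_sq hS₀.posSemidef Z
    (polarFactor_mul_transpose (posDef_sqrt_mul_mul_transpose hS₀ hX))

lemma trace_mul_mul_transpose_le (T : Matrix (Fin n) (Fin n) ℝ) (H : Matrix (Fin n) (Fin m) ℝ) :
    (T * (H * Hᵀ)).trace ≤ ‖T‖ * frobNorm H ^ 2 := by
  rw [← Matrix.mul_assoc, Matrix.trace_mul_comm]
  calc (Hᵀ * (T * H)).trace ≤ frobNorm H * frobNorm (T * H) := trace_transpose_mul_le _ _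
    _ ≤ frobNorm H * (‖T‖ * frobNorm H) :=
      mul_le_mul_of_nonneg_left (frobNorm_mul_le T H) (frobNorm_nonneg H)
    _ = ‖T‖ * frobNorm H ^ 2 := by ring

lemma exists_frobNorm_sub_nearestRoot_sq_sub_le_lossOne (hS₀ : S₀.PosDef)
    (hX : (X * Xᵀ).PosDef) : ∃ C, 0 ≤ C ∧ ∀ Z : Matrix (Fin n) (Fin m) ℝ,
      frobNorm (Z - nearestRoot S₀ X) ^ 2 - C * frobNorm (Z - X) ^ 2 ≤ lossOne S₀ Z := by
  set B := CFC.sqrt S₀ with hB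
  have hBX := posDef_sqrt_mul_mul_transpose hS₀ hX
  set R := CFC.sqrt (B * X * (B * X)ᵀ) with hR
  refine ⟨‖R⁻¹‖ * ‖B‖ ^ 2, by positivity, fun Z => ?_⟩
  have hsqrt := two_mul_trace_sqrt_add_le hBX (B * (Z - X))
  rw [← Matrix.mul_add, add_sub_cancel, ← hR, ← trace_transpose_mul_sqrt_mul, Matrix.transpose_sub,
    Matrix.sub_mul, Matrix.trace_sub, trace_transpose_mul_sqrt_mul X,
    trace_transpose_mul_polarFactor hBX, ← hR] at hsqrt
  have hsecond : (R⁻¹ * (B * (Z - X) * (B * (Z - X))ᵀ)).trace ≤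
      ‖R⁻¹‖ * ‖B‖ ^ 2 * frobNorm (Z - X) ^ 2 := by
    refine (trace_mul_mul_transpose_le _ _).trans ?_
    rw [mul_assoc, ← mul_pow]
    have := pow_le_pow_left₀ (frobNorm_nonneg _) (frobNorm_mul_le B (Z - X)) 2
    gcongr
  rw [lossOne_eq, frobNorm_sub_sq, frobNorm_nearestRoot hS₀ hX, nearestRoot, ← hB]
  linarith

end Loss

section LossDerivative

lemma hasFDerivAt_of_abs_sub_sub_le_sq {E : Type*} [NormedAddCommGroup E] [NormedSpace ℝ E]
    {f : E → ℝ} {ℓ : E →L[ℝ] ℝ} {x : E} {C : ℝ}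
    (h : ∀ y, |f y - f x - ℓ (y - x)| ≤ C * ‖y - x‖ ^ 2) : HasFDerivAt f ℓ x := by
  refine hasFDerivAt_iff_isLittleO.2 (Asymptotics.IsBigO.trans_isLittleO ?_
    (Asymptotics.isLittleO_pow_sub_sub x one_lt_two))
  refine Asymptotics.IsBigO.of_bound C (Filter.Eventually.of_forall fun y => ?_)
  simpa using h y

variable {n m : ℕ} {S₀ : Matrix (Fin n) (Fin n) ℝ} {X : Matrix (Fin n) (Fin m) ℝ}

/-- The linear form `H ↦ tr (Zᵀ H)`, which represents `Z` in the Frobenius scalar product. -/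
noncomputable def frobForm (Z : Matrix (Fin n) (Fin m) ℝ) : Matrix (Fin n) (Fin m) ℝ →L[ℝ] ℝ :=
  LinearMap.toContinuousLinearMap (Matrix.traceLinearMap (Fin m) ℝ ℝ ∘ₗ
    mulLeftLinearMap (Fin m) ℝ Zᵀ)

lemma frobForm_apply (Z H : Matrix (Fin n) (Fin m) ℝ) : frobForm Z H = (Zᵀ * H).trace := rfl

lemma frobNorm_sq_le_mul_norm_sq (H : Matrix (Fin n) (Fin m) ℝ) :
    frobNorm H ^ 2 ≤ frobNorm (1 : Matrix (Fin n) (Fin n) ℝ) ^ 2 * ‖H‖ ^ 2 := by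
  rw [← mul_pow]
  refine pow_le_pow_left₀ (frobNorm_nonneg H) ?_ 2
  simpa only [Matrix.one_mul] using frobNorm_mul_le_mul_norm (1 : Matrix (Fin n) (Fin n) ℝ) H

lemma hasFDerivAt_lossOne (hS₀ : S₀.PosDef) (hX : (X * Xᵀ).PosDef) :
    HasFDerivAt (lossOne S₀ : Matrix (Fin n) (Fin m) ℝ → ℝ)
      ((2 : ℝ) • frobForm (X - nearestRoot S₀ X)) X := by
  obtain ⟨C, hC, hlower⟩ := exists_frobNorm_sub_nearestRoot_sq_sub_le_lossOne hS₀ hX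
  refine hasFDerivAt_of_abs_sub_sub_le_sq
    (C := (1 + C) * frobNorm (1 : Matrix (Fin n) (Fin n) ℝ) ^ 2) fun Z => ?_
  have hexpand := frobNorm_add_sq (X - nearestRoot S₀ X) (Z - X)
  rw [show X - nearestRoot S₀ X + (Z - X) = Z - nearestRoot S₀ X by abel] at hexpand
  have hupper := lossOne_le_frobNorm_sub_nearestRoot_sq hS₀ hX Z
  have hfrob := mul_le_mul_of_nonneg_left (frobNorm_sq_le_mul_norm_sq (Z - X))
    (add_nonneg zero_le_one hC)
  have := mul_nonneg hC (sq_nonneg (frobNorm (Z - X)))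
  rw [smul_apply, frobForm_apply, smul_eq_mul,
    lossOne_eq_frobNorm_sub_nearestRoot_sq hS₀ hX, mul_assoc, abs_le]
  constructor <;> linarith [hlower Z, sq_nonneg (frobNorm (Z - X))]

end LossDerivative

section LayerProducts

variable {N : ℕ} {d : ℕ → ℕ}

/-- The product `W_N ⋯ W_{k+1}` of the layers above the first `k`. -/
def suffixProd (W : Params N d) {k : ℕ} (hk : k ≤ N) : Matrix (Fin (d N)) (Fin (d k)) ℝ :=
  Nat.decreasingInduction (motive := fun k _ => Matrix (Fin (d N)) (Fin (d k)) ℝ)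
    (fun k h A => A * W ⟨k, h⟩) 1 hk

lemma suffixProd_self (W : Params N d) : suffixProd W le_rfl = 1 :=
  Nat.decreasingInduction_self _ _

lemma suffixProd_of_lt (W : Params N d) {k : ℕ} (hk : k < N) :
    suffixProd W hk.le = suffixProd W (Nat.succ_le_of_lt hk) * W ⟨k, hk⟩ :=
  Nat.decreasingInduction_succ_left _ _ _ _

lemma suffixProd_mul_partialProd (W : Params N d) {k : ℕ} (hk : k ≤ N) :
    suffixProd W hk * partialProd W k hk = endToEnd W := by
  induction hk using Nat.decreasingInduction with
  | self => rw [suffixProd_self, Matrix.one_mul, endToEnd]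
  | of_succ k hk ih => rw [← ih, suffixProd_of_lt W hk, Matrix.mul_assoc, partialProd]

lemma partialProd_congr {W W' : Params N d} {k : ℕ} (hk : k ≤ N)
    (h : ∀ i (hi : i < k), W ⟨i, hi.trans_le hk⟩ = W' ⟨i, hi.trans_le hk⟩) :
    partialProd W k hk = partialProd W' k hk := by
  induction k with
  | zero => rfl
  | succ k ih => rw [partialProd, partialProd, h k k.lt_succ_self,
      ih _ fun i hi => h i (hi.trans k.lt_succ_self)]

lemma suffixProd_congr {W W' : Params N d} {k : ℕ} (hk : k ≤ N)
    (h : ∀ i (hi : i < N), k ≤ i → W ⟨i, hi⟩ = W' ⟨i, hi⟩) :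
    suffixProd W hk = suffixProd W' hk := by
  induction hk using Nat.decreasingInduction with
  | self => rw [suffixProd_self, suffixProd_self]
  | of_succ k hk ih =>
    rw [suffixProd_of_lt W hk, suffixProd_of_lt W' hk, h k hk le_rfl,
      ih fun i hi hki => h i hi (k.le_succ.trans hki)]

lemma endToEnd_add_single (W : Params N d) (j : Fin N)
    (E : Matrix (Fin (d (j + 1))) (Fin (d j)) ℝ) :
    endToEnd (W + (Pi.single j E : Params N d)) = endToEnd W +
      suffixProd W (Nat.succ_le_of_lt j.2) * E * partialProd W j j.2.le := by
  set W' : Params N d := W + (Pi.single j E : Params N d)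
  have hne (i : Fin N) (hi : (i : ℕ) ≠ j) : W' i = W i := by
    simp only [W', Pi.add_apply, Pi.single_eq_of_ne (Fin.val_ne_iff.1 hi), add_zero]
  have hprefix : partialProd W' j j.2.le = partialProd W j j.2.le :=
    partialProd_congr _ fun i hi => hne _ hi.ne
  have hsuffix : suffixProd W' (Nat.succ_le_of_lt j.2) = suffixProd W (Nat.succ_le_of_lt j.2) :=
    suffixProd_congr _ fun i _ hi => hne _ (Nat.lt_of_succ_le hi).ne'
  have hj : W' j = W j + E := by simp only [W', Pi.add_apply, Pi.single_eq_same]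
  rw [← suffixProd_mul_partialProd W' j.2.le, ← suffixProd_mul_partialProd W j.2.le,
    suffixProd_of_lt _ j.2, suffixProd_of_lt _ j.2, hprefix, hsuffix, hj, Matrix.mul_add,
    Matrix.add_mul]

lemma differentiable_partialProd_apply (k : ℕ) (hk : k ≤ N) (a : Fin (d k)) (b : Fin (d 0)) :
    Differentiable ℝ fun W : Params N d => partialProd W k hk a b := by
  induction k with
  | zero => exact differentiable_const _
  | succ k ih =>
    simp only [partialProd, Matrix.mul_apply]
    refine Differentiable.fun_sum fun i _ => Differentiable.mul ?_ (ih _ i)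
    exact (LinearMap.toContinuousLinearMap (Matrix.entryLinearMap ℝ ℝ a i ∘ₗ
      LinearMap.proj (φ := fun j : Fin N => Matrix (Fin (d (j + 1))) (Fin (d j)) ℝ)
        ⟨k, hk⟩)).differentiable

lemma differentiable_endToEnd :
    Differentiable ℝ (endToEnd : Params N d → Matrix (Fin (d N)) (Fin (d 0)) ℝ) := by
  have hsum : (endToEnd : Params N d → Matrix (Fin (d N)) (Fin (d 0)) ℝ) = fun W =>
      ∑ a, ∑ b, partialProd W N le_rfl a b • Matrix.single a b (1 : ℝ) := by
    funext W
    simpa only [Matrix.smul_single, smul_eq_mul, mul_one, endToEnd] using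
      Matrix.matrix_eq_sum_single (endToEnd W)
  rw [hsum]
  exact Differentiable.fun_sum fun a _ => Differentiable.fun_sum fun b _ =>
    (differentiable_partialProd_apply N le_rfl a b).smul_const _

end LayerProducts

section LossGradient

lemma trace_mul_single_mul {ι κ μ ν : Type*} [Fintype ι] [Fintype κ] [Fintype μ] [Fintype ν]
    [DecidableEq ι] [DecidableEq κ] (Z : Matrix μ ν ℝ) (A : Matrix μ ι ℝ) (a : ι) (b : κ)
    (B : Matrix κ ν ℝ) :
    (Zᵀ * (A * Matrix.single a b (1 : ℝ) * B)).trace = (Aᵀ * Z * Bᵀ) a b := by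
  have hcycle : (Zᵀ * (A * Matrix.single a b (1 : ℝ) * B)).trace =
      ((Aᵀ * Z * Bᵀ)ᵀ * Matrix.single a b (1 : ℝ)).trace := by
    rw [← Matrix.mul_assoc, Matrix.trace_mul_comm]
    simp only [Matrix.transpose_mul, Matrix.transpose_transpose, Matrix.mul_assoc]
  rw [hcycle, Matrix.trace_mul_single, Matrix.transpose_apply, MulOpposite.op_one, one_smul]

variable {N : ℕ} {d : ℕ → ℕ} {S₀ : Matrix (Fin (d N)) (Fin (d N)) ℝ} {W : Params N d}

lemma differentiableAt_lossN (hS₀ : S₀.PosDef) (hW : (endToEnd W * (endToEnd W)ᵀ).PosDef) :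
    DifferentiableAt ℝ (lossN S₀ : Params N d → ℝ) W :=
  (hasFDerivAt_lossOne hS₀ hW).differentiableAt.comp W differentiable_endToEnd.differentiableAt

lemma gradLossN_apply (hS₀ : S₀.PosDef) (hW : (endToEnd W * (endToEnd W)ᵀ).PosDef) (j : Fin N) :
    gradLossN S₀ W j = (2 : ℝ) • ((suffixProd W (Nat.succ_le_of_lt j.2))ᵀ *
      (endToEnd W - nearestRoot S₀ (endToEnd W)) * (partialProd W j j.2.le)ᵀ) := by
  ext a b
  have hlossOne := hasFDerivAt_lossOne hS₀ hW
  set E := Matrix.single a b (1 : ℝ)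
  set Z := suffixProd W (Nat.succ_le_of_lt j.2) * E * partialProd W j j.2.le with hZ
  have hline (t : ℝ) : endToEnd (W + t • (Pi.single j E : Params N d)) = endToEnd W + t • Z := by
    rw [← Pi.single_smul, endToEnd_add_single, Matrix.mul_smul, Matrix.smul_mul]
  calc gradLossN S₀ W j a b
      = lineDeriv ℝ (lossN S₀ : Params N d → ℝ) W (Pi.single j E) :=
        (differentiableAt_lossN hS₀ hW).lineDeriv_eq_fderiv.symm
    _ = lineDeriv ℝ (lossOne S₀) (endToEnd W) Z := by simp only [lineDeriv, lossN, hline]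
    _ = 2 * ((endToEnd W - nearestRoot S₀ (endToEnd W))ᵀ * Z).trace := by
        rw [hlossOne.differentiableAt.lineDeriv_eq_fderiv, hlossOne.fderiv]
        rfl
    _ = _ := by
        rw [hZ, trace_mul_single_mul, Matrix.smul_apply, smul_eq_mul]

end LossGradient

section SegmentProducts

/-- The product `w_{i+l-1} ⋯ w_i` of `l` consecutive terms of a sequence. -/
def segmentProd {R : Type*} [Monoid R] (w : ℕ → R) (i : ℕ) : ℕ → R
  | 0 => 1
  | l + 1 => w (i + l) * segmentProd w i l

lemma segmentProd_succ_right {R : Type*} [Monoid R] (w : ℕ → R) (i l : ℕ) :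
    segmentProd w i (l + 1) = segmentProd w (i + 1) l * w i := by
  induction l with
  | zero => simp only [segmentProd, add_zero, mul_one, one_mul]
  | succ l ih => rw [segmentProd, ih, segmentProd, mul_assoc, add_right_comm, add_assoc]

/-- The derivative of `w ↦ w_{N-1} ⋯ w_0` in the direction `h`. -/
def segmentProdDeriv {R : Type*} [Semiring R] (w h : ℕ → R) (N : ℕ) : R :=
  ∑ j ∈ Finset.range N, segmentProd w (j + 1) (N - 1 - j) * h j * segmentProd w 0 j

lemma segmentProdDeriv_succ {R : Type*} [Semiring R] (w h : ℕ → R) (k : ℕ) :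
    segmentProdDeriv w h (k + 1) = w k * segmentProdDeriv w h k + h k * segmentProd w 0 k := by
  have hlast : segmentProd w (k + 1) (k + 1 - 1 - k) = 1 := by
    rw [Nat.add_sub_cancel, Nat.sub_self, segmentProd]
  rw [segmentProdDeriv, Finset.sum_range_succ, hlast, one_mul, segmentProdDeriv, Finset.mul_sum]
  congr 1
  refine Finset.sum_congr rfl fun j hj => ?_
  have hjk := Finset.mem_range.1 hj
  rw [show k + 1 - 1 - j = (k - 1 - j) + 1 by omega, segmentProd,
    show j + 1 + (k - 1 - j) = k by omega]
  simp only [mul_assoc]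

lemma norm_segmentProd_le {R : Type*} [SeminormedRing R] (hone : ‖(1 : R)‖ ≤ 1) {w : ℕ → R}
    {m : ℝ} {i l : ℕ} (hw : ∀ j < l, ‖w (i + j)‖ ≤ m) :
    ‖segmentProd w i l‖ ≤ m ^ l := by
  induction l with
  | zero => simpa only [segmentProd, pow_zero] using hone
  | succ l ih =>
    rw [segmentProd, pow_succ']
    exact norm_mul_le_of_le (hw l l.lt_succ_self) (ih fun j hj => hw j (hj.trans l.lt_succ_self))

lemma pow_smul_one_le_segmentProd_mul_transpose {ι : Type*} [Fintype ι] [DecidableEq ι]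
    {w : ℕ → Matrix ι ι ℝ} {s : ℝ} (hs : 0 ≤ s) {i l : ℕ}
    (hw : ∀ j < l, s • 1 ≤ w (i + j) * (w (i + j))ᵀ) :
    s ^ l • 1 ≤ segmentProd w i l * (segmentProd w i l)ᵀ := by
  induction l with
  | zero => simp only [segmentProd, pow_zero, one_smul, Matrix.transpose_one, mul_one, le_refl]
  | succ l ih =>
    calc s ^ (l + 1) • (1 : Matrix ι ι ℝ) = s ^ l • s • (1 : Matrix ι ι ℝ) := by
          rw [smul_smul, pow_succ]
      _ ≤ s ^ l • (w (i + l) * (w (i + l))ᵀ) :=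
        smul_le_smul_of_nonneg_left (hw l l.lt_succ_self) (pow_nonneg hs l)
      _ = (w (i + l))ᵀᵀ * s ^ l • 1 * (w (i + l))ᵀ := by simp
      _ ≤ (w (i + l))ᵀᵀ * (segmentProd w i l * (segmentProd w i l)ᵀ) * (w (i + l))ᵀ :=
        transpose_mul_mul_le (ih fun j hj => hw j (hj.trans l.lt_succ_self)) _
      _ = _ := by simp only [segmentProd, Matrix.transpose_mul, Matrix.transpose_transpose,
          mul_assoc]

end SegmentProducts

section TaylorRemainder

variable {n N : ℕ} {w h : ℕ → Matrix (Fin n) (Fin n) ℝ} {m a : ℝ}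

lemma frobNorm_segmentProd_add_sub_le (hm : 0 ≤ m) (ha : 0 ≤ a) (hw : ∀ j < N, ‖w j‖ ≤ m)
    (hh : ∀ j < N, frobNorm (h j) ≤ a) :
    frobNorm (segmentProd (w + h) 0 N - segmentProd w 0 N) ≤ N * a * (m + a) ^ (N - 1) := by
  induction N with
  | zero => simp [segmentProd, frobNorm_zero]
  | succ k ih =>
    have hlt {j : ℕ} (hj : j < k) : j < k + 1 := hj.trans k.lt_succ_self
    set D := segmentProd (w + h) 0 k - segmentProd w 0 k
    have hD := ih (fun j hj => hw j (hlt hj)) fun j hj => hh j (hlt hj)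
    have hprod : ‖segmentProd (w + h) 0 k‖ ≤ (m + a) ^ k :=
      norm_segmentProd_le norm_one_matrix_le fun j hj => by
        rw [zero_add]
        exact norm_add_le_of_le (hw j (hlt hj)) ((norm_le_frobNorm _).trans (hh j (hlt hj)))
    have hsplit : segmentProd (w + h) 0 (k + 1) - segmentProd w 0 (k + 1) =
        w k * D + h k * segmentProd (w + h) 0 k := by
      simp only [D, segmentProd, zero_add, Pi.add_apply]
      noncomm_ring
    calc frobNorm (segmentProd (w + h) 0 (k + 1) - segmentProd w 0 (k + 1))
        ≤ ‖w k‖ * frobNorm D + frobNorm (h k) * ‖segmentProd (w + h) 0 k‖ := by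
          rw [hsplit]
          exact (frobNorm_add_le _ _).trans
            (add_le_add (frobNorm_mul_le _ _) (frobNorm_mul_le_mul_norm _ _))
      _ ≤ (m + a) * (k * a * (m + a) ^ (k - 1)) + a * (m + a) ^ k := by
          have := frobNorm_nonneg D
          gcongr
          · exact (hw k k.lt_succ_self).trans (le_add_of_nonneg_right ha)
          · exact hh k k.lt_succ_self
      _ = (k + 1 : ℕ) * a * (m + a) ^ (k + 1 - 1) := by
          rcases k with _ | k
          · simp
          · push_cast [Nat.add_sub_cancel]
            ring

lemma frobNorm_segmentProd_add_sub_sub_le (hm : 0 ≤ m) (ha : 0 ≤ a) (hw : ∀ j < N, ‖w j‖ ≤ m)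
    (hh : ∀ j < N, frobNorm (h j) ≤ a) :
    frobNorm (segmentProd (w + h) 0 N - segmentProd w 0 N - segmentProdDeriv w h N) ≤
      N * (N - 1) / 2 * a ^ 2 * (m + a) ^ (N - 2) := by
  induction N with
  | zero => simp [segmentProd, segmentProdDeriv, frobNorm_zero]
  | succ k ih =>
    have hlt {j : ℕ} (hj : j < k) : j < k + 1 := hj.trans k.lt_succ_self
    set D := segmentProd (w + h) 0 k - segmentProd w 0 k
    set R := D - segmentProdDeriv w h k
    have hR := ih (fun j hj => hw j (hlt hj)) fun j hj => hh j (hlt hj)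
    have hD : frobNorm D ≤ k * a * (m + a) ^ (k - 1) :=
      frobNorm_segmentProd_add_sub_le hm ha (fun j hj => hw j (hlt hj)) fun j hj => hh j (hlt hj)
    have hsplit : segmentProd (w + h) 0 (k + 1) - segmentProd w 0 (k + 1) -
        segmentProdDeriv w h (k + 1) = w k * R + h k * D := by
      simp only [R, D, segmentProd, segmentProdDeriv_succ, zero_add, Pi.add_apply]
      noncomm_ring
    calc frobNorm (segmentProd (w + h) 0 (k + 1) - segmentProd w 0 (k + 1) -
          segmentProdDeriv w h (k + 1))
        ≤ ‖w k‖ * frobNorm R + ‖h k‖ * frobNorm D := by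
          rw [hsplit]
          exact (frobNorm_add_le _ _).trans (add_le_add (frobNorm_mul_le _ _)
            (frobNorm_mul_le _ _))
      _ ≤ (m + a) * (k * (k - 1) / 2 * a ^ 2 * (m + a) ^ (k - 2)) +
          a * (k * a * (m + a) ^ (k - 1)) := by
          have := frobNorm_nonneg R
          have := frobNorm_nonneg D
          gcongr
          · exact (hw k k.lt_succ_self).trans (le_add_of_nonneg_right ha)
          · exact (norm_le_frobNorm _).trans (hh k k.lt_succ_self)
      _ = (k + 1 : ℕ) * ((k + 1 : ℕ) - 1) / 2 * a ^ 2 * (m + a) ^ (k + 1 - 2) := by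
          rcases k with _ | _ | k
          · simp
          · norm_num [sq]
          · push_cast [Nat.reduceSubDiff]
            ring

end TaylorRemainder

section DistanceGradient

variable {n N : ℕ} {w : ℕ → Matrix (Fin n) (Fin n) ℝ} {y : Matrix (Fin n) (Fin n) ℝ}

/-- The component `j` of the gradient of `w ↦ ‖w_{N-1} ⋯ w_0 - y‖²` for the Frobenius norm. -/
def distGrad (w : ℕ → Matrix (Fin n) (Fin n) ℝ) (N : ℕ) (y : Matrix (Fin n) (Fin n) ℝ) (j : ℕ) :
    Matrix (Fin n) (Fin n) ℝ :=
  (2 : ℝ) • ((segmentProd w (j + 1) (N - 1 - j))ᵀ * (segmentProd w 0 N - y) *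
    (segmentProd w 0 j)ᵀ)

lemma two_mul_trace_segmentProdDeriv (w h : ℕ → Matrix (Fin n) (Fin n) ℝ) (N : ℕ)
    (y : Matrix (Fin n) (Fin n) ℝ) :
    2 * ((segmentProd w 0 N - y)ᵀ * segmentProdDeriv w h N).trace =
      ∑ j ∈ Finset.range N, ((distGrad w N y j)ᵀ * h j).trace := by
  rw [segmentProdDeriv, Finset.mul_sum, Matrix.trace_sum, Finset.mul_sum]
  refine Finset.sum_congr rfl fun j _ => ?_
  rw [distGrad, Matrix.transpose_smul, Matrix.smul_mul, Matrix.trace_smul, smul_eq_mul,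
    ← Matrix.mul_assoc, Matrix.trace_mul_comm]
  simp only [Matrix.transpose_mul, Matrix.transpose_transpose, Matrix.mul_assoc]

lemma frobNorm_distGrad_le {m : ℝ} (hm : 0 ≤ m) (hw : ∀ j < N, ‖w j‖ ≤ m) {j : ℕ} (hj : j < N) :
    frobNorm (distGrad w N y j) ≤ 2 * m ^ (N - 1) * frobNorm (segmentProd w 0 N - y) := by
  set A := segmentProd w (j + 1) (N - 1 - j)
  set B := segmentProd w 0 j
  set z := segmentProd w 0 N - y
  have hz : 0 ≤ frobNorm z := frobNorm_nonneg z
  have hA : ‖Aᵀ‖ ≤ m ^ (N - 1 - j) := by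
    rw [norm_transpose]
    exact norm_segmentProd_le norm_one_matrix_le fun i hi => hw _ (by omega)
  have hB : ‖Bᵀ‖ ≤ m ^ j := by
    rw [norm_transpose]
    exact norm_segmentProd_le norm_one_matrix_le fun i hi => hw _ (by omega)
  calc frobNorm (distGrad w N y j) = 2 * frobNorm (Aᵀ * z * Bᵀ) := by
        rw [distGrad, frobNorm_smul, abs_two]
    _ ≤ 2 * (‖Aᵀ‖ * frobNorm z * ‖Bᵀ‖) := by
        gcongr
        exact (frobNorm_mul_le_mul_norm _ _).trans
          (mul_le_mul_of_nonneg_right (frobNorm_mul_le _ _) (norm_nonneg _))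
    _ ≤ 2 * (m ^ (N - 1 - j) * frobNorm z * m ^ j) := by gcongr
    _ = 2 * m ^ (N - 1) * frobNorm z := by
        rw [← pow_sub_mul_pow m (show j ≤ N - 1 by omega)]
        ring

lemma le_frobNorm_distGrad_sq {s : ℝ} (hs : 0 < s) (hw : ∀ j < N, s • 1 ≤ w j * (w j)ᵀ) {j : ℕ}
    (hj : j < N) :
    4 * s ^ (N - 1) * frobNorm (segmentProd w 0 N - y) ^ 2 ≤ frobNorm (distGrad w N y j) ^ 2 := by
  set A := segmentProd w (j + 1) (N - 1 - j)
  set B := segmentProd w 0 j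
  set z := segmentProd w 0 N - y
  have hA : s ^ (N - 1 - j) • 1 ≤ Aᵀᵀ * Aᵀ :=
    pow_smul_one_le_segmentProd_mul_transpose hs.le fun i hi => hw _ (by omega)
  have hB : s ^ j • 1 ≤ Bᵀ * B :=
    smul_one_le_mul_transpose (A := Bᵀ) (pow_pos hs j) <|
      pow_smul_one_le_segmentProd_mul_transpose hs.le fun i hi => hw _ (by omega)
  calc 4 * s ^ (N - 1) * frobNorm z ^ 2
      = 4 * (s ^ (N - 1 - j) * (s ^ j * frobNorm zᵀ ^ 2)) := by
        rw [frobNorm_transpose, ← pow_sub_mul_pow s (show j ≤ N - 1 by omega)]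
        ring
    _ ≤ 4 * (s ^ (N - 1 - j) * frobNorm (z * Bᵀ) ^ 2) := by
        rw [← frobNorm_transpose (z * Bᵀ), Matrix.transpose_mul, Matrix.transpose_transpose]
        gcongr
        exact mul_frobNorm_sq_le hB _
    _ ≤ 4 * frobNorm (Aᵀ * (z * Bᵀ)) ^ 2 := by
        gcongr
        exact mul_frobNorm_sq_le hA _
    _ = frobNorm (distGrad w N y j) ^ 2 := by
        rw [distGrad, frobNorm_smul, abs_two, Matrix.mul_assoc]
        ring

end DistanceGradient

section Imbalance

variable {n N : ℕ} {w : ℕ → Matrix (Fin n) (Fin n) ℝ} {y : Matrix (Fin n) (Fin n) ℝ}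

/-- The failure of balancedness between the layers `j` and `j + 1`. -/
def imbalance (w : ℕ → Matrix (Fin n) (Fin n) ℝ) (j : ℕ) : Matrix (Fin n) (Fin n) ℝ :=
  w j * (w j)ᵀ - (w (j + 1))ᵀ * w (j + 1)

lemma transpose_imbalance (w : ℕ → Matrix (Fin n) (Fin n) ℝ) (j : ℕ) :
    (imbalance w j)ᵀ = imbalance w j := by
  simp [imbalance]

lemma mul_transpose_eq_add_imbalance (w : ℕ → Matrix (Fin n) (Fin n) ℝ) (j : ℕ) :
    w j * (w j)ᵀ = (w (j + 1))ᵀ * w (j + 1) + imbalance w j :=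
  (add_sub_cancel _ _).symm

lemma mul_transpose_distGrad {j : ℕ} (hj : j + 1 < N) :
    w j * (distGrad w N y j)ᵀ = (distGrad w N y (j + 1))ᵀ * w (j + 1) := by
  rw [distGrad, distGrad, show N - 1 - j = (N - 1 - (j + 1)) + 1 by omega, segmentProd_succ_right]
  simp only [segmentProd, zero_add, Matrix.transpose_smul, Matrix.transpose_mul,
    Matrix.transpose_transpose, Matrix.mul_smul, Matrix.smul_mul, Matrix.mul_assoc]

lemma imbalance_sub_smul_distGrad (η : ℝ) {j : ℕ} (hj : j + 1 < N) :
    imbalance (w - η • distGrad w N y) j = imbalance w j +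
      η ^ 2 • (distGrad w N y j * (distGrad w N y j)ᵀ -
        (distGrad w N y (j + 1))ᵀ * distGrad w N y (j + 1)) := by
  have hcross := mul_transpose_distGrad (w := w) (y := y) hj
  have hcross' := congrArg Matrix.transpose hcross
  simp only [Matrix.transpose_mul, Matrix.transpose_transpose] at hcross'
  simp only [imbalance, Pi.sub_apply, Pi.smul_apply, Matrix.transpose_sub, Matrix.transpose_smul,
    Matrix.sub_mul, Matrix.mul_sub, Matrix.mul_smul, Matrix.smul_mul, hcross, hcross']
  module

lemma norm_imbalance_sub_smul_distGrad_le (η : ℝ) {j : ℕ} (hj : j + 1 < N) :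
    ‖imbalance (w - η • distGrad w N y) j‖ ≤ ‖imbalance w j‖ +
      η ^ 2 * (frobNorm (distGrad w N y j) ^ 2 + frobNorm (distGrad w N y (j + 1)) ^ 2) := by
  have hsq (A : Matrix (Fin n) (Fin n) ℝ) : ‖A‖ * ‖A‖ ≤ frobNorm A ^ 2 := by
    rw [sq]
    exact mul_self_le_mul_self (norm_nonneg _) (norm_le_frobNorm _)
  rw [imbalance_sub_smul_distGrad η hj]
  refine (norm_add_le _ _).trans (add_le_add_right ?_ _)
  rw [norm_smul, Real.norm_of_nonneg (sq_nonneg η)]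
  gcongr
  refine (norm_sub_le _ _).trans (add_le_add ?_ ?_)
  · exact (norm_mul_le _ _).trans (by rw [norm_transpose]; exact hsq _)
  · exact (norm_mul_le _ _).trans (by rw [norm_transpose]; exact hsq _)

lemma sum_norm_imbalance_sub_smul_distGrad_le (η : ℝ) :
    ∑ j ∈ Finset.range (N - 1), ‖imbalance (w - η • distGrad w N y) j‖ ≤
      ∑ j ∈ Finset.range (N - 1), ‖imbalance w j‖ +
        2 * η ^ 2 * ∑ j ∈ Finset.range N, frobNorm (distGrad w N y j) ^ 2 := by
  rcases N with _ | k
  · simp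
  rw [Nat.add_sub_cancel]
  set g := fun j => frobNorm (distGrad w (k + 1) y j) ^ 2
  have hinit : ∑ j ∈ Finset.range k, g j ≤ ∑ j ∈ Finset.range (k + 1), g j := by
    rw [Finset.sum_range_succ]
    exact le_add_of_nonneg_right (sq_nonneg _)
  have htail : ∑ j ∈ Finset.range k, g (j + 1) ≤ ∑ j ∈ Finset.range (k + 1), g j := by
    rw [Finset.sum_range_succ']
    exact le_add_of_nonneg_right (sq_nonneg _)
  calc ∑ j ∈ Finset.range k, ‖imbalance (w - η • distGrad w (k + 1) y) j‖
      ≤ ∑ j ∈ Finset.range k, (‖imbalance w j‖ + η ^ 2 * (g j + g (j + 1))) :=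
        Finset.sum_le_sum fun j hj => norm_imbalance_sub_smul_distGrad_le η
          (Nat.succ_lt_succ (Finset.mem_range.1 hj))
    _ = ∑ j ∈ Finset.range k, ‖imbalance w j‖ + η ^ 2 *
          (∑ j ∈ Finset.range k, g j + ∑ j ∈ Finset.range k, g (j + 1)) := by
        rw [Finset.sum_add_distrib, ← Finset.mul_sum, Finset.sum_add_distrib]
    _ ≤ _ := by
        rw [mul_comm 2, mul_assoc, two_mul]
        gcongr

end Imbalance

section SelfAdjointPowers

lemma pow_norm_le_norm_pow {E : Type*} [NormedRing E] [StarRing E] [CStarRing E] {x : E}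
    (hx : IsSelfAdjoint x) {N : ℕ} (hN : N ≠ 0) : ‖x‖ ^ N ≤ ‖x ^ N‖ := by
  rcases (norm_nonneg x).eq_or_lt with h | h
  · rw [← h, zero_pow hN]
    exact norm_nonneg _
  -- The equality `‖x ^ 2 ^ N‖ = ‖x‖ ^ 2 ^ N` leaves no room for a loss in the power `x ^ N`.
  have hlt : N < 2 ^ N := Nat.lt_two_pow_self
  refine le_of_mul_le_mul_right ?_ (pow_pos h (2 ^ N - N))
  calc ‖x‖ ^ N * ‖x‖ ^ (2 ^ N - N) = ‖x ^ N * x ^ (2 ^ N - N)‖ := by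
        rw [pow_mul_pow_sub _ hlt.le, pow_mul_pow_sub _ hlt.le, hx.norm_pow_two_pow]
    _ ≤ ‖x ^ N‖ * ‖x‖ ^ (2 ^ N - N) := (norm_mul_le _ _).trans
        (mul_le_mul_of_nonneg_left (norm_pow_le' x (Nat.sub_pos_of_lt hlt)) (norm_nonneg _))

lemma norm_pow_succ_sub_pow_succ_le {R : Type*} [SeminormedRing R] {P Q : R} {r : ℝ}
    (hP : ‖P‖ ≤ r) (hQ : ‖Q‖ ≤ r) (k : ℕ) :
    ‖P ^ (k + 1) - Q ^ (k + 1)‖ ≤ (k + 1) * r ^ k * ‖P - Q‖ := by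
  have hr : 0 ≤ r := (norm_nonneg P).trans hP
  induction k with
  | zero => simp
  | succ k ih =>
    have hQk : ‖Q ^ (k + 1)‖ ≤ r ^ (k + 1) :=
      (norm_pow_le' Q k.succ_pos).trans (pow_le_pow_left₀ (norm_nonneg _) hQ _)
    calc ‖P ^ (k + 1 + 1) - Q ^ (k + 1 + 1)‖
        = ‖P * (P ^ (k + 1) - Q ^ (k + 1)) + (P - Q) * Q ^ (k + 1)‖ := by
          rw [pow_succ' P, pow_succ' Q (k + 1)]
          noncomm_ring
      _ ≤ ‖P‖ * ‖P ^ (k + 1) - Q ^ (k + 1)‖ + ‖P - Q‖ * ‖Q ^ (k + 1)‖ :=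
        norm_add_le_of_le (norm_mul_le _ _) (norm_mul_le _ _)
      _ ≤ r * ((k + 1) * r ^ k * ‖P - Q‖) + ‖P - Q‖ * r ^ (k + 1) := by gcongr
      _ = ((k + 1 : ℕ) + 1) * r ^ (k + 1) * ‖P - Q‖ := by push_cast; ring

end SelfAdjointPowers

section ScalarBounds

variable {k : ℕ} {r m κ δ X s : ℝ}

lemma pow_mul_sub_le_sub_pow (hr : 0 < r) (hδr : δ ≤ r) :
    r ^ k * (r - (k + 1) * δ) ≤ (r - δ) ^ (k + 1) := by
  have hδ : -2 ≤ -(δ / r) := by linarith [(div_le_one hr).2 hδr]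
  calc r ^ k * (r - (k + 1) * δ) = r ^ (k + 1) * (1 + (k + 1 : ℕ) * -(δ / r)) := by
        push_cast
        field_simp
        ring
    _ ≤ r ^ (k + 1) * (1 + -(δ / r)) ^ (k + 1) := by
        gcongr
        exact one_add_mul_le_pow hδ (k + 1)
    _ = (r - δ) ^ (k + 1) := by
        rw [← mul_pow, mul_add, mul_one, mul_neg, mul_div_cancel₀ _ hr.ne', sub_eq_add_neg]

lemma le_of_add_mul_pow_le (hm : 0 < m) (hδ : 0 ≤ δ) (hX : 0 ≤ X)
    (h : X + 2 * (k + 1) * δ * m ^ k ≤ m ^ (k + 1)) : δ ≤ m := by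
  have : 2 * (k + 1) * δ ≤ m := by
    refine le_of_mul_le_mul_right ?_ (pow_pos hm k)
    rw [← pow_succ']
    linarith
  nlinarith [(Nat.cast_nonneg k : (0 : ℝ) ≤ k)]

lemma le_of_sub_pow_le (hm : 0 < m) (hδ : 0 ≤ δ) (hX : 0 ≤ X)
    (h : X + 2 * (k + 1) * δ * m ^ k ≤ m ^ (k + 1))
    (hr : δ ≤ r → (r - δ) ^ (k + 1) ≤ X + k * r ^ k * δ) : r ≤ m := by
  by_contra! hmr
  have hδm := le_of_add_mul_pow_le hm hδ hX h
  have hbernoulli := pow_mul_sub_le_sub_pow (k := k) (hm.trans hmr) (hδm.trans hmr.le)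
  have hnonneg : 0 ≤ m - 2 * (k + 1) * δ := by
    refine nonneg_of_mul_nonneg_right (a := m ^ k) ?_ (pow_pos hm k)
    rw [mul_sub, ← pow_succ]
    linarith
  have hgrow : m ^ k * (m - 2 * (k + 1) * δ) < r ^ k * (r - 2 * (k + 1) * δ) :=
    mul_lt_mul' (pow_le_pow_left₀ hm.le hmr.le k) (by linarith) hnonneg
      (pow_pos (hm.trans hmr) k)
  have : 0 ≤ r ^ k * δ := mul_nonneg (pow_nonneg (hm.trans hmr).le k) hδ
  rw [pow_succ] at h
  linarith [hr (hδm.trans hmr.le)]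

lemma add_pow_add_le (hm : 0 < m) (hκ : 0 < κ) (hδ : 0 ≤ δ)
    (h : X + 2 * (k + 1) * δ * m ^ k ≤ m ^ (k + 1))
    (h' : κ ^ (k + 1) + 2 * (k + 1) * δ * m ^ k ≤ s) (hsX : s ≤ X) :
    (κ + δ) ^ (k + 1) + k * m ^ k * δ ≤ s := by
  have hδk : 0 ≤ δ * m ^ k := by positivity
  have hkδ : 0 ≤ (k + 1) * (δ * m ^ k) := by positivity
  have hκk : 0 < κ ^ (k + 1) := pow_pos hκ _
  have hδm : δ ≤ m := le_of_add_mul_pow_le hm hδ (by linarith) h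
  have hκδ : κ + δ ≤ m := by
    have hbernoulli := pow_mul_sub_le_sub_pow (k := k) hm hδm
    have hpow : κ ^ (k + 1) ≤ (m - δ) ^ (k + 1) := by
      rw [mul_sub, ← pow_succ] at hbernoulli
      linarith
    linarith [le_of_pow_le_pow_left₀ k.succ_ne_zero (sub_nonneg.2 hδm) hpow]
  have hbernoulli := pow_mul_sub_le_sub_pow (k := k) (r := κ + δ) (by linarith)
    (le_add_of_nonneg_left hκ.le)
  rw [add_sub_cancel_right, mul_sub, ← pow_succ] at hbernoulli
  have : (κ + δ) ^ k * ((k + 1) * δ) ≤ m ^ k * ((k + 1) * δ) := by gcongr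
  linarith

end ScalarBounds

section AlmostBalanced

variable {n k : ℕ} {w : ℕ → Matrix (Fin n) (Fin n) ℝ}

lemma norm_transpose_mul_self (A : Matrix (Fin n) (Fin n) ℝ) : ‖Aᵀ * A‖ = ‖A‖ ^ 2 := by
  rw [← Matrix.conjTranspose_eq_transpose_of_trivial, Matrix.l2_opNorm_conjTranspose_mul_self, sq]

lemma norm_mul_transpose_self (A : Matrix (Fin n) (Fin n) ℝ) : ‖A * Aᵀ‖ = ‖A‖ ^ 2 := by
  simpa only [Matrix.transpose_transpose, norm_transpose] using norm_transpose_mul_self Aᵀ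

lemma norm_mul_mul_transpose_sub_pow_le (A P : Matrix (Fin n) (Fin n) ℝ) (k : ℕ) :
    ‖A * P * Aᵀ - (A * Aᵀ) ^ (k + 1)‖ ≤ ‖A‖ ^ 2 * ‖P - (Aᵀ * A) ^ k‖ := by
  have hpow : (A * Aᵀ) ^ (k + 1) = A * (Aᵀ * A) ^ k * Aᵀ := by
    rw [← mul_pow_mul, pow_succ]
    simp only [mul_assoc]
  calc ‖A * P * Aᵀ - (A * Aᵀ) ^ (k + 1)‖ = ‖A * (P - (Aᵀ * A) ^ k) * Aᵀ‖ := by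
        rw [hpow, Matrix.mul_sub, Matrix.sub_mul]
    _ ≤ ‖A‖ * ‖P - (Aᵀ * A) ^ k‖ * ‖Aᵀ‖ := norm_mul_le_of_le (norm_mul_le _ _) le_rfl
    _ = ‖A‖ ^ 2 * ‖P - (Aᵀ * A) ^ k‖ := by
        rw [norm_transpose]
        ring

lemma norm_segmentProd_mul_transpose_sub_pow_le {r : ℝ} (hw : ∀ j ≤ k, ‖w j‖ ^ 2 ≤ r) :
    ‖segmentProd w 0 (k + 1) * (segmentProd w 0 (k + 1))ᵀ - (w k * (w k)ᵀ) ^ (k + 1)‖ ≤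
      k * r ^ k * ∑ j ∈ Finset.range k, ‖imbalance w j‖ := by
  have hr : 0 ≤ r := (sq_nonneg _).trans (hw 0 k.zero_le)
  induction k with
  | zero => simp [segmentProd]
  | succ k ih =>
    set P := segmentProd w 0 (k + 1) * (segmentProd w 0 (k + 1))ᵀ
    set A := w (k + 1)
    set B := w k * (w k)ᵀ
    set S := ∑ j ∈ Finset.range k, ‖imbalance w j‖ with hS
    have hP : ‖P - B ^ (k + 1)‖ ≤ k * r ^ k * S := ih fun j hj => hw j (Nat.le_succ_of_le hj)
    have hB : ‖B ^ (k + 1) - (Aᵀ * A) ^ (k + 1)‖ ≤ (k + 1) * r ^ k * ‖imbalance w k‖ :=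
      norm_pow_succ_sub_pow_succ_le ((norm_mul_transpose_self _).trans_le (hw k k.le_succ))
        ((norm_transpose_mul_self _).trans_le (hw (k + 1) le_rfl)) k
    have hprod : segmentProd w 0 (k + 1 + 1) * (segmentProd w 0 (k + 1 + 1))ᵀ = A * P * Aᵀ := by
      rw [segmentProd, zero_add]
      simp only [P, A, Matrix.transpose_mul, Matrix.mul_assoc]
    calc ‖segmentProd w 0 (k + 1 + 1) * (segmentProd w 0 (k + 1 + 1))ᵀ - (A * Aᵀ) ^ (k + 1 + 1)‖
        ≤ ‖A‖ ^ 2 * ‖P - (Aᵀ * A) ^ (k + 1)‖ := by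
          rw [hprod]
          exact norm_mul_mul_transpose_sub_pow_le A P (k + 1)
      _ ≤ r * (k * r ^ k * S + (k + 1) * r ^ k * ‖imbalance w k‖) :=
          mul_le_mul (hw (k + 1) le_rfl)
            ((norm_sub_le_norm_sub_add_norm_sub _ _ _).trans (add_le_add hP hB)) (norm_nonneg _) hr
      _ ≤ (k + 1 : ℕ) * r ^ (k + 1) * ∑ j ∈ Finset.range (k + 1), ‖imbalance w j‖ := by
          have : 0 ≤ r ^ (k + 1) * S :=
            mul_nonneg (pow_nonneg hr _) (Finset.sum_nonneg fun _ _ => norm_nonneg _)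
          rw [Finset.sum_range_succ, ← hS]
          push_cast
          linear_combination this

lemma norm_sq_le_add_sum_norm_imbalance {j : ℕ} (hj : j ≤ k) :
    ‖w j‖ ^ 2 ≤ ‖w k‖ ^ 2 + ∑ i ∈ Finset.range k, ‖imbalance w i‖ := by
  suffices hmono : ‖w j‖ ^ 2 + ∑ i ∈ Finset.range j, ‖imbalance w i‖ ≤
      ‖w k‖ ^ 2 + ∑ i ∈ Finset.range k, ‖imbalance w i‖ from
    (le_add_of_nonneg_right (Finset.sum_nonneg fun _ _ => norm_nonneg _)).trans hmono
  induction k, hj using Nat.le_induction with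
  | base => rfl
  | succ k _ ih =>
    have hstep := norm_add_le ((w (k + 1))ᵀ * w (k + 1)) (imbalance w k)
    rw [← mul_transpose_eq_add_imbalance, norm_mul_transpose_self, norm_transpose_mul_self]
      at hstep
    rw [Finset.sum_range_succ]
    linarith

lemma smul_one_le_smul_one {s t : ℝ} (h : s ≤ t) :
    s • (1 : Matrix (Fin n) (Fin n) ℝ) ≤ t • 1 :=
  smul_le_smul_of_nonneg_right h zero_le_one

lemma add_sum_smul_one_le_mul_transpose {s : ℝ} (hs : 0 < s)
    (hk : (s + ∑ i ∈ Finset.range k, ‖imbalance w i‖) • 1 ≤ w k * (w k)ᵀ) {j : ℕ} (hj : j ≤ k) :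
    (s + ∑ i ∈ Finset.range j, ‖imbalance w i‖) • 1 ≤ w j * (w j)ᵀ := by
  induction hj using Nat.decreasingInduction with
  | self => exact hk
  | of_succ j _ ih =>
    have hpos : 0 < s + ∑ i ∈ Finset.range (j + 1), ‖imbalance w i‖ :=
      add_pos_of_pos_of_nonneg hs (Finset.sum_nonneg fun _ _ => norm_nonneg _)
    have hnext : (s + ∑ i ∈ Finset.range (j + 1), ‖imbalance w i‖) • 1 ≤
        (w (j + 1))ᵀ * w (j + 1) :=
      smul_one_le_mul_transpose (A := (w (j + 1))ᵀ) hpos ih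
    calc (s + ∑ i ∈ Finset.range j, ‖imbalance w i‖) • (1 : Matrix (Fin n) (Fin n) ℝ)
        = (s + ∑ i ∈ Finset.range (j + 1), ‖imbalance w i‖) • 1 + -(‖imbalance w j‖ • 1) := by
          rw [Finset.sum_range_succ]
          module
      _ ≤ w j * (w j)ᵀ := by
          rw [mul_transpose_eq_add_imbalance]
          exact add_le_add hnext (neg_norm_smul_one_le (transpose_imbalance w j))

lemma norm_sq_le_of_imbalance {m X δ : ℝ} (hm : 0 < m)
    (hδ : ∑ i ∈ Finset.range k, ‖imbalance w i‖ ≤ δ)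
    (hX : ‖segmentProd w 0 (k + 1)‖ ^ 2 ≤ X)
    (h : X + 2 * (k + 1) * δ * m ^ k ≤ m ^ (k + 1)) {j : ℕ} (hj : j ≤ k) : ‖w j‖ ^ 2 ≤ m := by
  have hδ0 : 0 ≤ δ := (Finset.sum_nonneg fun _ _ => norm_nonneg _).trans hδ
  have hX0 : 0 ≤ X := (sq_nonneg _).trans hX
  obtain ⟨i, hi, hmax⟩ := Finset.exists_max_image (Finset.range (k + 1)) (fun j => ‖w j‖ ^ 2)
    ⟨0, Finset.mem_range.2 k.succ_pos⟩
  set r := ‖w i‖ ^ 2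
  have hr (j : ℕ) (hj : j ≤ k) : ‖w j‖ ^ 2 ≤ r := hmax j (Finset.mem_range_succ_iff.2 hj)
  refine (hr j hj).trans (le_of_sub_pow_le (k := k) hm hδ0 hX0 h fun hδr => ?_)
  have hlast : r - δ ≤ ‖w k‖ ^ 2 := by
    linarith [norm_sq_le_add_sum_norm_imbalance (w := w) (Finset.mem_range_succ_iff.1 hi)]
  set P := segmentProd w 0 (k + 1) * (segmentProd w 0 (k + 1))ᵀ
  calc (r - δ) ^ (k + 1) ≤ (‖w k‖ ^ 2) ^ (k + 1) := pow_le_pow_left₀ (by linarith) hlast _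
    _ ≤ ‖(w k * (w k)ᵀ) ^ (k + 1)‖ := by
        rw [← norm_mul_transpose_self]
        exact pow_norm_le_norm_pow (isSelfAdjoint_of_transpose_eq (by simp)) k.succ_ne_zero
    _ ≤ ‖P‖ + ‖P - (w k * (w k)ᵀ) ^ (k + 1)‖ := by
        simpa only [sub_sub_cancel] using norm_sub_le P (P - (w k * (w k)ᵀ) ^ (k + 1))
    _ ≤ X + k * r ^ k * δ := by
        rw [norm_mul_transpose_self]
        gcongr
        exact (norm_segmentProd_mul_transpose_sub_pow_le hr).trans (by gcongr)

lemma smul_one_le_mul_transpose_of_imbalance {m X δ κ s : ℝ} (hm : 0 < m) (hκ : 0 < κ)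
    (hδ : ∑ i ∈ Finset.range k, ‖imbalance w i‖ ≤ δ)
    (hX : ‖segmentProd w 0 (k + 1)‖ ^ 2 ≤ X)
    (h : X + 2 * (k + 1) * δ * m ^ k ≤ m ^ (k + 1))
    (hs : s • 1 ≤ segmentProd w 0 (k + 1) * (segmentProd w 0 (k + 1))ᵀ)
    (h' : κ ^ (k + 1) + 2 * (k + 1) * δ * m ^ k ≤ s) (hsX : s ≤ X) {j : ℕ} (hj : j ≤ k) :
    κ • 1 ≤ w j * (w j)ᵀ := by
  have hδ0 : 0 ≤ δ := (Finset.sum_nonneg fun _ _ => norm_nonneg _).trans hδ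
  set P := segmentProd w 0 (k + 1) * (segmentProd w 0 (k + 1))ᵀ
  set B := w k * (w k)ᵀ
  have hdist : ‖P - B ^ (k + 1)‖ ≤ k * m ^ k * δ :=
    (norm_segmentProd_mul_transpose_sub_pow_le fun j hj =>
      norm_sq_le_of_imbalance hm hδ hX h hj).trans (by gcongr)
  have hpow : (κ + δ) ^ (k + 1) • 1 ≤ B ^ (k + 1) := by
    calc (κ + δ) ^ (k + 1) • (1 : Matrix (Fin n) (Fin n) ℝ)
        ≤ (s - ‖P - B ^ (k + 1)‖) • 1 :=
          smul_one_le_smul_one (by linarith [add_pow_add_le hm hκ hδ0 h h' hsX])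
      _ = s • 1 - ‖P - B ^ (k + 1)‖ • 1 := sub_smul _ _ _
      _ ≤ P - (P - B ^ (k + 1)) :=
          sub_le_sub hs (le_norm_smul_one (by simp [P, B]))
      _ = B ^ (k + 1) := sub_sub_cancel _ _
  have hlast : (κ + ∑ i ∈ Finset.range k, ‖imbalance w i‖) • 1 ≤ B :=
    (smul_one_le_smul_one (by linarith)).trans <|
      smul_one_le_of_le_pow (posSemidef_mul_transpose _).nonneg k.succ_ne_zero hpow
  exact (smul_one_le_smul_one
    (le_add_of_nonneg_right (Finset.sum_nonneg fun _ _ => norm_nonneg _))).trans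
      (add_sum_smul_one_le_mul_transpose hκ hlast hj)

end AlmostBalanced

section GradientStep

variable {n N : ℕ} {w : ℕ → Matrix (Fin n) (Fin n) ℝ} {y : Matrix (Fin n) (Fin n) ℝ}

lemma le_sum_frobNorm_distGrad_sq {s : ℝ} (hs : 0 < s) (hw : ∀ j < N, s • 1 ≤ w j * (w j)ᵀ) :
    4 * N * s ^ (N - 1) * frobNorm (segmentProd w 0 N - y) ^ 2 ≤
      ∑ j ∈ Finset.range N, frobNorm (distGrad w N y j) ^ 2 := by
  have h := Finset.card_nsmul_le_sum (Finset.range N) _ _ fun j hj =>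
    le_frobNorm_distGrad_sq (y := y) hs hw (Finset.mem_range.1 hj)
  rw [Finset.card_range, nsmul_eq_mul] at h
  linarith

lemma frobNorm_segmentProd_sub_smul_distGrad_sub_sq_le {m a η : ℝ} (hm : 0 ≤ m) (ha : 0 ≤ a)
    (hw : ∀ j < N, ‖w j‖ ≤ m) (hstep : ∀ j < N, frobNorm (η • distGrad w N y j) ≤ a) :
    frobNorm (segmentProd (w - η • distGrad w N y) 0 N - y) ^ 2 ≤
      frobNorm (segmentProd w 0 N - y) ^ 2 -
        η * ∑ j ∈ Finset.range N, frobNorm (distGrad w N y j) ^ 2 +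
      (2 * frobNorm (segmentProd w 0 N - y) * (N * (N - 1) / 2 * a ^ 2 * (m + a) ^ (N - 2)) +
        (N * a * (m + a) ^ (N - 1)) ^ 2) := by
  set h := -(η • distGrad w N y) with hdef
  set x := segmentProd w 0 N
  set x' := segmentProd (w + h) 0 N
  set D := segmentProdDeriv w h N
  have hh : ∀ j < N, frobNorm (h j) ≤ a := fun j hj => by
    simpa only [hdef, Pi.neg_apply, Pi.smul_apply, frobNorm_neg] using hstep j hj
  have hfirst : 2 * ((x - y)ᵀ * D).trace =
      -(η * ∑ j ∈ Finset.range N, frobNorm (distGrad w N y j) ^ 2) := by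
    simp only [x, D, hdef, two_mul_trace_segmentProdDeriv, Pi.neg_apply, Pi.smul_apply,
      Matrix.mul_neg, Matrix.mul_smul, Matrix.trace_neg, Matrix.trace_smul, smul_eq_mul,
      frobNorm_sq, Finset.sum_neg_distrib, Finset.mul_sum]
  have hremainder : ((x - y)ᵀ * (x' - x - D)).trace ≤
      frobNorm (x - y) * (N * (N - 1) / 2 * a ^ 2 * (m + a) ^ (N - 2)) :=
    (trace_transpose_mul_le _ _).trans (mul_le_mul_of_nonneg_left
      (frobNorm_segmentProd_add_sub_sub_le hm ha hw hh) (frobNorm_nonneg _))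
  have hquadratic : frobNorm (x' - x) ^ 2 ≤ (N * a * (m + a) ^ (N - 1)) ^ 2 :=
    pow_le_pow_left₀ (frobNorm_nonneg _) (frobNorm_segmentProd_add_sub_le hm ha hw hh) 2
  have hsplit : ((x - y)ᵀ * (x' - x)).trace =
      ((x - y)ᵀ * D).trace + ((x - y)ᵀ * (x' - x - D)).trace := by
    rw [← Matrix.trace_add, ← Matrix.mul_add, add_sub_cancel]
  rw [sub_eq_add_neg w, ← sub_add_sub_cancel' x y x', frobNorm_add_sq, hsplit]
  linarith

/-- The two properties of a step of gradient descent on `w ↦ ‖w_{N-1} ⋯ w_0 - y‖²` that make the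
loss decrease geometrically: the gradient dominates the loss, and the loss decreases by a fixed
proportion of the squared norm of the gradient. -/
structure SufficientDecrease (η ρ : ℝ) (w : ℕ → Matrix (Fin n) (Fin n) ℝ) (N : ℕ)
    (y : Matrix (Fin n) (Fin n) ℝ) : Prop where
  loss_le : 4 * N * ρ * frobNorm (segmentProd w 0 N - y) ^ 2 ≤
    ∑ j ∈ Finset.range N, frobNorm (distGrad w N y j) ^ 2
  step_le : frobNorm (segmentProd (w - η • distGrad w N y) 0 N - y) ^ 2 ≤
    frobNorm (segmentProd w 0 N - y) ^ 2 -
      η / 2 * ∑ j ∈ Finset.range N, frobNorm (distGrad w N y j) ^ 2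

lemma sufficientDecrease_single {η : ℝ} (hη : 0 ≤ η) (hη' : η ≤ 1 / 4) :
    SufficientDecrease η 1 w 1 y := by
  have hprod (v : ℕ → Matrix (Fin n) (Fin n) ℝ) : segmentProd v 0 1 = v 0 := by
    simp only [segmentProd, add_zero, mul_one]
  have hgrad : distGrad w 1 y 0 = (2 : ℝ) • (w 0 - y) := by
    simp only [distGrad, hprod]
    simp [segmentProd]
  have hnext : (w - η • distGrad w 1 y) 0 - y = (1 - 2 * η) • (w 0 - y) := by
    simp only [Pi.sub_apply, Pi.smul_apply, hgrad]
    module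
  have hsq : 0 ≤ frobNorm (w 0 - y) ^ 2 := sq_nonneg _
  constructor <;> simp only [Finset.sum_range_one, hprod, hnext, hgrad, frobNorm_smul, mul_pow,
    sq_abs, Nat.cast_one]
  · linarith
  · nlinarith [mul_nonneg (mul_nonneg hη hsq) (sub_nonneg.2 hη')]

end GradientStep

section StepSize

variable {p : ℕ} {l σ F m κ η : ℝ}

lemma add_pow_le_mul_pow {a : ℝ} {q : ℕ} (hm : 0 < m) (ha : 0 ≤ a) (h : 8 * q * a ≤ m) :
    (m + a) ^ q ≤ 8 / 7 * m ^ q := by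
  have hexp : Real.exp (1 / 8) ≤ 8 / 7 :=
    (Real.exp_bound_div_one_sub_of_interval (by norm_num) (by norm_num)).trans (by norm_num)
  have hqa : q * (a / m) ≤ 1 / 8 := by
    rw [← mul_div_assoc, div_le_iff₀ hm]
    linarith
  calc (m + a) ^ q = (1 + a / m) ^ q * m ^ q := by
        rw [← mul_pow, add_mul, one_mul, div_mul_cancel₀ _ hm.ne']
    _ ≤ Real.exp (a / m) ^ q * m ^ q := by
        gcongr
        linarith [Real.add_one_le_exp (a / m)]
    _ ≤ 8 / 7 * m ^ q := by
        rw [← Real.exp_nat_mul]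
        gcongr
        exact (Real.exp_le_exp.2 hqa).trans hexp

/-- The scalar assumptions on the initialization and the step size of a network with `p + 2`
layers: `l ^ 2` bounds the initial loss, `σ` and `F` are the smallest singular value and the
Frobenius norm of `Σ₀^{1/2}`, and `κ` and `m` turn out to bound the singular values of all layers
along gradient descent. -/
structure StepsizeBound (p : ℕ) (l σ F m κ η : ℝ) : Prop where
  l_nonneg : 0 ≤ l
  η_nonneg : 0 ≤ η
  κ_pos : 0 < κ
  m_pos : 0 < m
  margin : l + κ ^ (p + 2) ≤ σ
  σ_le : σ ≤ F
  m_pow : (m ^ (p + 2)) ^ 2 = 2 * (l ^ 2 + F ^ 2)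
  η_le : η * (16 * (p + 1) * m ^ (3 * p + 2) * F) ≤ κ ^ (2 * p + 2)

namespace StepsizeBound

lemma κ_pow_le (h : StepsizeBound p l σ F m κ η) : κ ^ (p + 2) ≤ F := by
  linarith [h.margin, h.l_nonneg, h.σ_le]

lemma F_pos (h : StepsizeBound p l σ F m κ η) : 0 < F :=
  (pow_pos h.κ_pos _).trans_le h.κ_pow_le

lemma l_le (h : StepsizeBound p l σ F m κ η) : l ≤ F := by
  linarith [h.margin, h.σ_le, pow_pos h.κ_pos (p + 2)]

lemma m_pow_le (h : StepsizeBound p l σ F m κ η) : m ^ (p + 2) ≤ 2 * F := by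
  refine le_of_sq_le_sq ?_ (by linarith [h.F_pos])
  rw [h.m_pow]
  linarith [pow_le_pow_left₀ h.l_nonneg h.l_le 2, mul_pow 2 F 2]

lemma two_mul_l_le (h : StepsizeBound p l σ F m κ η) : 2 * l ≤ m ^ (p + 2) := by
  refine le_of_sq_le_sq ?_ (pow_pos h.m_pos _).le
  rw [h.m_pow]
  linarith [pow_le_pow_left₀ h.l_nonneg h.l_le 2, mul_pow 2 l 2]

lemma κ_le (h : StepsizeBound p l σ F m κ η) : κ ≤ m := by
  have hF : F ≤ m ^ (p + 2) := by
    refine le_of_sq_le_sq ?_ (pow_pos h.m_pos _).le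
    rw [h.m_pow]
    linarith [sq_nonneg l, sq_nonneg F]
  exact le_of_pow_le_pow_left₀ (p + 1).succ_ne_zero h.m_pos.le (h.κ_pow_le.trans hF)

lemma η_mul_le_m_pow (h : StepsizeBound p l σ F m κ η) :
    8 * (p + 1) * (η * (2 * m ^ (p + 1) * F)) ≤ m := by
  refine le_of_mul_le_mul_right ?_ (pow_pos h.m_pos (2 * p + 1))
  calc 8 * (p + 1) * (η * (2 * m ^ (p + 1) * F)) * m ^ (2 * p + 1)
      = η * (16 * (p + 1) * m ^ (3 * p + 2) * F) := by ring
    _ ≤ κ ^ (2 * p + 2) := h.η_le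
    _ ≤ m ^ (2 * p + 2) := pow_le_pow_left₀ h.κ_pos.le h.κ_le _
    _ = m * m ^ (2 * p + 1) := by ring

lemma taylor_remainder_le (h : StepsizeBound p l σ F m κ η) {e a : ℝ} (he : 0 ≤ e) (heF : e ≤ F)
    (ha : a = η * (2 * m ^ (p + 1) * e)) (hpow : (m + a) ^ p ≤ 8 / 7 * m ^ p) :
    2 * e * ((p + 2) * (p + 1) / 2 * a ^ 2 * (m + a) ^ p) ≤
      2 / 7 * (η * (p + 2) * κ ^ (2 * p + 2) * e ^ 2) := by
  have hη := h.η_nonneg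
  have hm := h.m_pos
  calc 2 * e * ((p + 2) * (p + 1) / 2 * a ^ 2 * (m + a) ^ p)
      ≤ 2 * e * ((p + 2) * (p + 1) / 2 * a ^ 2 * (8 / 7 * m ^ p)) := by gcongr
    _ = 2 / 7 * (η * (p + 2) * (η * (16 * (p + 1) * m ^ (3 * p + 2) * e)) * e ^ 2) := by
        rw [ha]
        ring
    _ ≤ 2 / 7 * (η * (p + 2) * (η * (16 * (p + 1) * m ^ (3 * p + 2) * F)) * e ^ 2) := by gcongr
    _ ≤ 2 / 7 * (η * (p + 2) * κ ^ (2 * p + 2) * e ^ 2) := by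
        gcongr
        exact h.η_le

lemma sq_step_le (h : StepsizeBound p l σ F m κ η) {e a : ℝ} (he : 0 ≤ e)
    (ha : a = η * (2 * m ^ (p + 1) * e)) (hpow : (m + a) ^ (p + 1) ≤ 8 / 7 * m ^ (p + 1)) :
    ((p + 2) * a * (m + a) ^ (p + 1)) ^ 2 ≤
      64 / 49 * (η * (p + 2) * κ ^ (2 * p + 2) * e ^ 2) := by
  have hη := h.η_nonneg
  have hm := h.m_pos
  have ha0 : 0 ≤ a := by
    rw [ha]
    positivity
  have hp : (p + 2 : ℝ) ≤ 2 * (p + 1) := by linarith [(Nat.cast_nonneg p : (0 : ℝ) ≤ p)]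
  calc ((p + 2) * a * (m + a) ^ (p + 1)) ^ 2
      ≤ ((p + 2) * a * (8 / 7 * m ^ (p + 1))) ^ 2 := by gcongr
    _ = 64 / 49 * (η * (p + 2) * (4 * (p + 2) * η * m ^ (3 * p + 2) * m ^ (p + 2)) * e ^ 2) := by
        rw [ha]
        ring
    _ ≤ 64 / 49 *
        (η * (p + 2) * (4 * (2 * (p + 1)) * η * m ^ (3 * p + 2) * (2 * F)) * e ^ 2) := by
        gcongr
        exact h.m_pow_le
    _ = 64 / 49 * (η * (p + 2) * (η * (16 * (p + 1) * m ^ (3 * p + 2) * F)) * e ^ 2) := by ring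
    _ ≤ 64 / 49 * (η * (p + 2) * κ ^ (2 * p + 2) * e ^ 2) := by
        gcongr
        exact h.η_le

lemma second_order_le (h : StepsizeBound p l σ F m κ η) {e a : ℝ} (he : 0 ≤ e) (heF : e ≤ F)
    (ha : a = η * (2 * m ^ (p + 1) * e)) :
    2 * e * ((p + 2) * (p + 1) / 2 * a ^ 2 * (m + a) ^ p) +
      ((p + 2) * a * (m + a) ^ (p + 1)) ^ 2 ≤ 2 * (η * (p + 2) * κ ^ (2 * p + 2) * e ^ 2) := by
  have hη := h.η_nonneg
  have hm := h.m_pos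
  have hκ := h.κ_pos
  have ha0 : 0 ≤ a := by
    rw [ha]
    positivity
  have hsmall : 8 * (p + 1) * a ≤ m := by
    rw [ha]
    refine le_trans ?_ h.η_mul_le_m_pow
    gcongr
  have hremainder := h.taylor_remainder_le he heF ha (add_pow_le_mul_pow hm ha0 (by linarith))
  have hsq := h.sq_step_le he ha (add_pow_le_mul_pow hm ha0 (by exact_mod_cast hsmall))
  have : 0 ≤ η * (p + 2) * κ ^ (2 * p + 2) * e ^ 2 := by positivity
  linarith

lemma sufficientDecrease {n : ℕ} {w : ℕ → Matrix (Fin n) (Fin n) ℝ}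
    {y : Matrix (Fin n) (Fin n) ℝ} (h : StepsizeBound p l σ F m κ η)
    (he : frobNorm (segmentProd w 0 (p + 2) - y) ≤ l) (hwm : ∀ j < p + 2, ‖w j‖ ≤ m)
    (hwκ : ∀ j < p + 2, κ ^ 2 • 1 ≤ w j * (w j)ᵀ) :
    SufficientDecrease η (κ ^ (2 * p + 2)) w (p + 2) y := by
  have hη := h.η_nonneg
  have hm := h.m_pos
  set e := frobNorm (segmentProd w 0 (p + 2) - y)
  have he0 : 0 ≤ e := frobNorm_nonneg _
  have hloss : 4 * (p + 2 : ℕ) * κ ^ (2 * p + 2) * e ^ 2 ≤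
      ∑ j ∈ Finset.range (p + 2), frobNorm (distGrad w (p + 2) y j) ^ 2 := by
    rw [show 2 * p + 2 = 2 * (p + 2 - 1) by omega, pow_mul]
    exact le_sum_frobNorm_distGrad_sq (pow_pos h.κ_pos 2) hwκ
  refine ⟨hloss, ?_⟩
  have hstep (j : ℕ) (hj : j < p + 2) :
      frobNorm (η • distGrad w (p + 2) y j) ≤ η * (2 * m ^ (p + 1) * e) := by
    rw [frobNorm_smul, abs_of_nonneg hη]
    exact mul_le_mul_of_nonneg_left (frobNorm_distGrad_le hm.le hwm hj) hη
  have htaylor := frobNorm_segmentProd_sub_smul_distGrad_sub_sq_le hm.le (by positivity) hwm hstep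
  have hsecond := h.second_order_le he0 (he.trans h.l_le) rfl
  have hfirst := mul_le_mul_of_nonneg_left hloss hη
  simp only [Nat.add_sub_cancel, show p + 2 - 1 = p + 1 by omega] at htaylor
  push_cast at htaylor hfirst
  linarith

end StepsizeBound

end StepSize

section LayerBounds

variable {n q : ℕ}

lemma smul_one_le_mul_transpose_iff {A : Matrix (Fin n) (Fin q) ℝ} {s : ℝ} (hs : 0 ≤ s) :
    s ^ 2 • 1 ≤ A * Aᵀ ↔
      ∀ v : Fin n → ℝ, s * ‖WithLp.toLp 2 v‖ ≤ ‖WithLp.toLp 2 (Aᵀ *ᵥ v)‖ := by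
  have hquadratic (v : Fin n → ℝ) : star v ⬝ᵥ ((A * Aᵀ - s ^ 2 • 1) *ᵥ v) =
      ‖WithLp.toLp 2 (Aᵀ *ᵥ v)‖ ^ 2 - (s * ‖WithLp.toLp 2 v‖) ^ 2 := by
    rw [Matrix.sub_mulVec, dotProduct_sub, ← Matrix.mulVec_mulVec, Matrix.dotProduct_mulVec,
      star_trivial, ← Matrix.mulVec_transpose, Matrix.smul_mulVec, Matrix.one_mulVec,
      dotProduct_smul, mul_pow, EuclideanSpace.real_norm_sq_eq, EuclideanSpace.real_norm_sq_eq]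
    simp only [dotProduct, sq, smul_eq_mul]
  have hsymm : (A * Aᵀ - s ^ 2 • 1).IsHermitian :=
    isSelfAdjoint_of_transpose_eq (by simp)
  simp only [Matrix.le_iff, Matrix.posSemidef_iff_dotProduct_mulVec, hquadratic, sub_nonneg,
    hsymm, true_and]
  exact forall_congr' fun v => sq_le_sq₀ (by positivity) (norm_nonneg _)

lemma smul_one_le_mul_transpose_of_frobNorm_sub_le {X Y : Matrix (Fin n) (Fin q) ℝ} {σ e : ℝ}
    (hY : σ ^ 2 • 1 ≤ Y * Yᵀ) (he : frobNorm (X - Y) ≤ e) (heσ : e ≤ σ) :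
    (σ - e) ^ 2 • 1 ≤ X * Xᵀ := by
  have hσ : 0 ≤ σ := (frobNorm_nonneg _).trans (he.trans heσ)
  rw [smul_one_le_mul_transpose_iff (sub_nonneg.2 heσ)]
  rw [smul_one_le_mul_transpose_iff hσ] at hY
  intro v
  have hdiff : ‖WithLp.toLp 2 ((Y - X)ᵀ *ᵥ v)‖ ≤ e * ‖WithLp.toLp 2 v‖ := by
    refine (norm_toLp_mulVec_le_frobNorm _ v).trans ?_
    rw [frobNorm_transpose, frobNorm_sub_comm]
    gcongr
  have htriangle : ‖WithLp.toLp 2 (Yᵀ *ᵥ v)‖ ≤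
      ‖WithLp.toLp 2 (Xᵀ *ᵥ v)‖ + ‖WithLp.toLp 2 ((Y - X)ᵀ *ᵥ v)‖ := by
    simpa [← WithLp.toLp_add, ← Matrix.add_mulVec] using
      norm_add_le (WithLp.toLp 2 (Xᵀ *ᵥ v)) (WithLp.toLp 2 ((Y - X)ᵀ *ᵥ v))
  linarith [hY v]

namespace StepsizeBound

variable {p : ℕ} {l σ F m κ η e : ℝ}

lemma coeff_mul_le (h : StepsizeBound p l σ F m κ η) :
    4 * (p + 2) * η * m ^ (2 * p + 2) * m ^ (2 * p + 2) ≤ κ ^ (2 * p + 2) := by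
  have hη := h.η_nonneg
  have hm := h.m_pos
  have hp : (p + 2 : ℝ) ≤ 2 * (p + 1) := by linarith [(Nat.cast_nonneg p : (0 : ℝ) ≤ p)]
  calc 4 * (p + 2) * η * m ^ (2 * p + 2) * m ^ (2 * p + 2)
      = 4 * (p + 2) * η * m ^ (3 * p + 2) * m ^ (p + 2) := by ring
    _ ≤ 4 * (2 * (p + 1)) * η * m ^ (3 * p + 2) * (2 * F) := by
        gcongr
        exact h.m_pow_le
    _ = η * (16 * (p + 1) * m ^ (3 * p + 2) * F) := by ring
    _ ≤ κ ^ (2 * p + 2) := h.η_le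

lemma coeff_le_one (h : StepsizeBound p l σ F m κ η) :
    4 * (p + 2) * η * m ^ (2 * p + 2) ≤ 1 := by
  refine le_of_mul_le_mul_right (a := m ^ (2 * p + 2)) ?_ (pow_pos h.m_pos _)
  rw [one_mul]
  exact h.coeff_mul_le.trans (pow_le_pow_left₀ h.κ_pos.le h.κ_le _)

lemma coeff_mul_m_pow_le (h : StepsizeBound p l σ F m κ η) :
    4 * (p + 2) * η * m ^ (2 * p + 2) * m ^ (p + 2) ≤ κ ^ (p + 2) := by
  have hκ := h.κ_pos
  refine le_of_mul_le_mul_right (a := m ^ p) ?_ (pow_pos h.m_pos _)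
  calc 4 * (p + 2) * η * m ^ (2 * p + 2) * m ^ (p + 2) * m ^ p
      = 4 * (p + 2) * η * m ^ (2 * p + 2) * m ^ (2 * p + 2) := by ring
    _ ≤ κ ^ (2 * p + 2) := h.coeff_mul_le
    _ = κ ^ (p + 2) * κ ^ p := by ring
    _ ≤ κ ^ (p + 2) * m ^ p := by
        gcongr
        exact h.κ_le

lemma upper_margin_le (h : StepsizeBound p l σ F m κ η) (he : 0 ≤ e) (hel : e ≤ l) :
    (F + e) ^ 2 + 2 * (p + 2) * (4 * η * (l ^ 2 - e ^ 2)) * m ^ (2 * p + 2) ≤ m ^ (2 * p + 4) := by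
  have hm : m ^ (2 * p + 4) = 2 * (l ^ 2 + F ^ 2) := by
    rw [← h.m_pow]
    ring
  have hcoeff := mul_le_mul_of_nonneg_right h.coeff_le_one
    (sub_nonneg.2 (pow_le_pow_left₀ he hel 2))
  linarith [sq_nonneg (F - e), add_sq F e, sub_sq F e]

lemma lower_margin_le (h : StepsizeBound p l σ F m κ η) (hel : e ≤ l) :
    κ ^ (2 * p + 4) + 2 * (p + 2) * (4 * η * (l ^ 2 - e ^ 2)) * m ^ (2 * p + 2) ≤
      (σ - e) ^ 2 := by
  have hη := h.η_nonneg
  have hm := h.m_pos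
  have hle : 0 ≤ l - e := sub_nonneg.2 hel
  have hcoeff : 4 * (p + 2) * η * m ^ (2 * p + 2) * (l + e) ≤ κ ^ (p + 2) :=
    le_trans (by gcongr; linarith [h.two_mul_l_le]) h.coeff_mul_m_pow_le
  calc κ ^ (2 * p + 4) + 2 * (p + 2) * (4 * η * (l ^ 2 - e ^ 2)) * m ^ (2 * p + 2)
      = (κ ^ (p + 2)) ^ 2 + 2 * (4 * (p + 2) * η * m ^ (2 * p + 2) * (l + e)) * (l - e) := by ring
    _ ≤ (κ ^ (p + 2)) ^ 2 + 2 * κ ^ (p + 2) * (l - e) + (l - e) ^ 2 := by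
        rw [← add_zero ((κ ^ (p + 2)) ^ 2 + _)]
        gcongr
        exact sq_nonneg _
    _ = (κ ^ (p + 2) + (l - e)) ^ 2 := by ring
    _ ≤ (σ - e) ^ 2 :=
        pow_le_pow_left₀ (add_nonneg (pow_pos h.κ_pos _).le hle) (by linarith [h.margin]) 2

lemma norm_le_and_smul_one_le {w : ℕ → Matrix (Fin n) (Fin n) ℝ} {y : Matrix (Fin n) (Fin n) ℝ}
    (h : StepsizeBound p l σ F m κ η) (hyF : frobNorm y = F) (hyσ : σ ^ 2 • 1 ≤ y * yᵀ)
    (he : frobNorm (segmentProd w 0 (p + 2) - y) ≤ l)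
    (hδ : ∑ j ∈ Finset.range (p + 1), ‖imbalance w j‖ ≤
      4 * η * (l ^ 2 - frobNorm (segmentProd w 0 (p + 2) - y) ^ 2)) {j : ℕ} (hj : j < p + 2) :
    ‖w j‖ ≤ m ∧ κ ^ 2 • 1 ≤ w j * (w j)ᵀ := by
  set e := frobNorm (segmentProd w 0 (p + 2) - y)
  have he0 : 0 ≤ e := frobNorm_nonneg _
  have heσ : e ≤ σ := by linarith [h.margin, pow_pos h.κ_pos (p + 2)]
  have hnorm : ‖segmentProd w 0 (p + 2)‖ ^ 2 ≤ (F + e) ^ 2 := by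
    refine pow_le_pow_left₀ (norm_nonneg _) ((norm_le_frobNorm _).trans ?_) 2
    simpa only [add_sub_cancel, hyF] using frobNorm_add_le y (segmentProd w 0 (p + 2) - y)
  have hupper : (F + e) ^ 2 + 2 * ((p + 1 : ℕ) + 1) * (4 * η * (l ^ 2 - e ^ 2)) *
      (m ^ 2) ^ (p + 1) ≤ (m ^ 2) ^ (p + 1 + 1) := by
    convert h.upper_margin_le he0 he using 1 <;> push_cast <;> ring
  have hlower : (κ ^ 2) ^ (p + 1 + 1) + 2 * ((p + 1 : ℕ) + 1) * (4 * η * (l ^ 2 - e ^ 2)) *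
      (m ^ 2) ^ (p + 1) ≤ (σ - e) ^ 2 := by
    convert h.lower_margin_le he using 1
    push_cast
    ring
  have hσF : (σ - e) ^ 2 ≤ (F + e) ^ 2 :=
    pow_le_pow_left₀ (sub_nonneg.2 heσ) (by linarith [h.σ_le]) 2
  have hjp : j ≤ p + 1 := Nat.le_of_lt_succ hj
  refine ⟨le_of_sq_le_sq ?_ h.m_pos.le, ?_⟩
  · exact norm_sq_le_of_imbalance (pow_pos h.m_pos 2) hδ hnorm hupper hjp
  · exact smul_one_le_mul_transpose_of_imbalance (pow_pos h.m_pos 2) (pow_pos h.κ_pos 2) hδ hnorm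
      hupper (smul_one_le_mul_transpose_of_frobNorm_sub_le hyσ le_rfl heσ) hlower hσF hjp

end StepsizeBound

end LayerBounds

section SquareReduction

lemma frobNorm_mul_transpose_of_isometry {n p q : ℕ} (A : Matrix (Fin p) (Fin n) ℝ)
    {U : Matrix (Fin q) (Fin n) ℝ} (hU : Uᵀ * U = 1) : frobNorm (A * Uᵀ) = frobNorm A := by
  rw [← sq_eq_sq₀ (frobNorm_nonneg _) (frobNorm_nonneg _), frobNorm_sq_eq_trace_mul_transpose,
    frobNorm_sq_eq_trace_mul_transpose, Matrix.transpose_mul, Matrix.transpose_transpose,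
    Matrix.mul_assoc, ← Matrix.mul_assoc Uᵀ, hU, Matrix.one_mul]

variable {N : ℕ} {d : ℕ → ℕ}

/-- The layers of `W` are the square matrices `w` seen through isometric embeddings `U` of the
output space into all the layer spaces, the embedding into the output space itself being the
identity. -/
structure IsIsometricLift (U : (j : ℕ) → Matrix (Fin (d j)) (Fin (d N)) ℝ)
    (w : ℕ → Matrix (Fin (d N)) (Fin (d N)) ℝ) (W : Params N d) : Prop where
  isometry : ∀ j ≤ N, (U j)ᵀ * U j = 1
  last : U N = 1
  eq : ∀ (j : ℕ) (hj : j < N), W ⟨j, hj⟩ = U (j + 1) * w j * (U j)ᵀ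

namespace IsIsometricLift

variable {U : (j : ℕ) → Matrix (Fin (d j)) (Fin (d N)) ℝ}
  {w : ℕ → Matrix (Fin (d N)) (Fin (d N)) ℝ} {W : Params N d}

lemma suffixProd_eq (h : IsIsometricLift U w W) {k : ℕ} (hk : k ≤ N) :
    suffixProd W hk = segmentProd w k (N - k) * (U k)ᵀ := by
  induction hk using Nat.decreasingInduction with
  | self => rw [suffixProd_self, h.last, Nat.sub_self, segmentProd, Matrix.transpose_one, mul_one]
  | of_succ k hk ih =>
    calc suffixProd W hk.le
        = segmentProd w (k + 1) (N - (k + 1)) * ((U (k + 1))ᵀ * U (k + 1)) * w k * (U k)ᵀ := by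
          rw [suffixProd_of_lt W hk, ih, h.eq k hk]
          simp only [Matrix.mul_assoc]
      _ = segmentProd w k (N - k) * (U k)ᵀ := by
          rw [h.isometry (k + 1) hk, Matrix.mul_one, ← segmentProd_succ_right,
            show N - (k + 1) + 1 = N - k by omega]

lemma partialProd_mul_eq (h : IsIsometricLift U w W) {k : ℕ} (hk : k ≤ N) :
    partialProd W k hk * U 0 = U k * segmentProd w 0 k := by
  induction k with
  | zero => rw [partialProd, segmentProd, Matrix.one_mul, Matrix.mul_one]
  | succ k ih =>
    calc partialProd W (k + 1) hk * U 0
        = U (k + 1) * w k * ((U k)ᵀ * U k) * segmentProd w 0 k := by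
          rw [partialProd, Matrix.mul_assoc, ih (Nat.le_of_succ_le hk), h.eq k hk]
          simp only [Matrix.mul_assoc]
      _ = U (k + 1) * segmentProd w 0 (k + 1) := by
          rw [h.isometry k (Nat.le_of_succ_le hk), Matrix.mul_one, Matrix.mul_assoc, segmentProd,
            zero_add]

lemma endToEnd_eq (h : IsIsometricLift U w W) : endToEnd W = segmentProd w 0 N * (U 0)ᵀ := by
  rw [← suffixProd_mul_partialProd W (Nat.zero_le N), h.suffixProd_eq, partialProd, Nat.sub_zero,
    Matrix.mul_one]

lemma endToEnd_mul_transpose (h : IsIsometricLift U w W) :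
    endToEnd W * (endToEnd W)ᵀ = segmentProd w 0 N * (segmentProd w 0 N)ᵀ := by
  rw [h.endToEnd_eq, Matrix.transpose_mul, Matrix.transpose_transpose, Matrix.mul_assoc,
    ← Matrix.mul_assoc (U 0)ᵀ, h.isometry 0 (Nat.zero_le N), Matrix.one_mul]

variable {S₀ : Matrix (Fin (d N)) (Fin (d N)) ℝ}

lemma endToEnd_sub_nearestRoot (h : IsIsometricLift U w W) :
    endToEnd W - nearestRoot S₀ (endToEnd W) =
      (segmentProd w 0 N - nearestRoot S₀ (segmentProd w 0 N)) * (U 0)ᵀ := by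
  rw [h.endToEnd_eq, nearestRoot_mul_transpose_of_isometry (h.isometry 0 N.zero_le),
    Matrix.sub_mul]

lemma lossN_eq (h : IsIsometricLift U w W) (hS₀ : S₀.PosDef)
    (hW : (endToEnd W * (endToEnd W)ᵀ).PosDef) :
    lossN S₀ W =
      frobNorm (segmentProd w 0 N - nearestRoot S₀ (segmentProd w 0 N)) ^ 2 := by
  rw [lossN, lossOne_eq_frobNorm_sub_nearestRoot_sq hS₀ hW, h.endToEnd_sub_nearestRoot,
    frobNorm_mul_transpose_of_isometry _ (h.isometry 0 N.zero_le)]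

lemma lossN_le {x : Matrix (Fin (d N)) (Fin (d N)) ℝ} (h : IsIsometricLift U w W)
    (hS₀ : S₀.PosDef) (hx : (x * xᵀ).PosDef) :
    lossN S₀ W ≤ frobNorm (segmentProd w 0 N - nearestRoot S₀ x) ^ 2 := by
  have hU := h.isometry 0 N.zero_le
  have hxU : (x * (U 0)ᵀ * (x * (U 0)ᵀ)ᵀ).PosDef := by
    rwa [Matrix.transpose_mul, Matrix.transpose_transpose, Matrix.mul_assoc,
      ← Matrix.mul_assoc (U 0)ᵀ, hU, Matrix.one_mul]
  refine (lossOne_le_frobNorm_sub_nearestRoot_sq hS₀ hxU (endToEnd W)).trans_eq ?_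
  rw [h.endToEnd_eq, nearestRoot_mul_transpose_of_isometry hU, ← Matrix.sub_mul,
    frobNorm_mul_transpose_of_isometry _ hU]

lemma gradLossN_eq (h : IsIsometricLift U w W) (hS₀ : S₀.PosDef)
    (hW : (endToEnd W * (endToEnd W)ᵀ).PosDef) (j : ℕ) (hj : j < N) :
    gradLossN S₀ W ⟨j, hj⟩ =
      U (j + 1) * distGrad w N (nearestRoot S₀ (segmentProd w 0 N)) j * (U j)ᵀ := by
  have hpartial : (U 0)ᵀ * (partialProd W j hj.le)ᵀ = (segmentProd w 0 j)ᵀ * (U j)ᵀ := by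
    rw [← Matrix.transpose_mul, h.partialProd_mul_eq hj.le, Matrix.transpose_mul]
  rw [gradLossN_apply hS₀ hW ⟨j, hj⟩, h.suffixProd_eq, h.endToEnd_sub_nearestRoot,
    Matrix.transpose_mul, Matrix.transpose_transpose, distGrad,
    show N - (j + 1) = N - 1 - j by omega]
  simp only [Matrix.mul_smul, Matrix.smul_mul, Matrix.mul_assoc, hpartial]

lemma sub_smul_gradLossN (h : IsIsometricLift U w W) (hS₀ : S₀.PosDef)
    (hW : (endToEnd W * (endToEnd W)ᵀ).PosDef) (η : ℝ) :
    IsIsometricLift U (w - η • distGrad w N (nearestRoot S₀ (segmentProd w 0 N)))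
      (W - η • gradLossN S₀ W) where
  isometry := h.isometry
  last := h.last
  eq j hj := by
    simp only [Pi.sub_apply, Pi.smul_apply, h.gradLossN_eq hS₀ hW j hj, h.eq j hj, Matrix.mul_sub,
      Matrix.sub_mul, Matrix.mul_smul, Matrix.smul_mul]

end IsIsometricLift

section Balanced

lemma posDef_mul_transpose_of_isUnit_mul {n p : ℕ} {A : Matrix (Fin n) (Fin p) ℝ}
    {B : Matrix (Fin p) (Fin n) ℝ} (h : IsUnit (A * B)) : (A * Aᵀ).PosDef := by
  have hinj : Function.Injective ((· ᵥ* B) ∘ (· ᵥ* A)) := by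
    simpa only [Function.comp_def, Matrix.vecMul_vecMul] using
      Matrix.vecMul_injective_iff_isUnit.2 h
  simpa using Matrix.PosDef.mul_conjTranspose_self A hinj.of_comp

variable {n p q : ℕ} {A : Matrix (Fin p) (Fin q) ℝ} {V : Matrix (Fin p) (Fin n) ℝ}
  {b : Matrix (Fin n) (Fin n) ℝ}

lemma transpose_inv_of_transpose_eq (hb : bᵀ = b) : b⁻¹ᵀ = b⁻¹ := by
  rw [Matrix.transpose_nonsing_inv, hb]

lemma isometry_transpose_mul_mul_inv (hb : IsUnit b.det) (hbt : bᵀ = b) (hV : Vᵀ * V = 1)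
    (hA : A * Aᵀ = V * (b * b) * Vᵀ) : (Aᵀ * V * b⁻¹)ᵀ * (Aᵀ * V * b⁻¹) = 1 := by
  calc (Aᵀ * V * b⁻¹)ᵀ * (Aᵀ * V * b⁻¹) = b⁻¹ * (Vᵀ * (A * Aᵀ) * V) * b⁻¹ := by
        rw [Matrix.transpose_mul, Matrix.transpose_mul, Matrix.transpose_transpose,
          transpose_inv_of_transpose_eq hbt]
        simp only [Matrix.mul_assoc]
    _ = b⁻¹ * ((Vᵀ * V) * (b * b) * (Vᵀ * V)) * b⁻¹ := by
        rw [hA]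
        simp only [Matrix.mul_assoc]
    _ = (b⁻¹ * b) * (b * b⁻¹) := by
        rw [hV, Matrix.one_mul, Matrix.mul_one]
        simp only [Matrix.mul_assoc]
    _ = 1 := by rw [Matrix.nonsing_inv_mul b hb, Matrix.mul_nonsing_inv b hb, Matrix.one_mul]

lemma eq_mul_mul_transpose_of_isometry (hb : IsUnit b.det) (hbt : bᵀ = b) (hV : Vᵀ * V = 1)
    (hA : A * Aᵀ = V * (b * b) * Vᵀ) : A = V * b * (Aᵀ * V * b⁻¹)ᵀ := by
  have hproj : (1 - V * Vᵀ) * V = 0 := by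
    rw [Matrix.sub_mul, Matrix.one_mul, Matrix.mul_assoc, hV, Matrix.mul_one, sub_self]
  have hrange : (1 - V * Vᵀ) * A = 0 := by
    refine Matrix.self_mul_conjTranspose_eq_zero.1 ?_
    rw [Matrix.conjTranspose_eq_transpose_of_trivial, Matrix.transpose_mul, Matrix.mul_assoc,
      ← Matrix.mul_assoc A, hA]
    simp only [← Matrix.mul_assoc, hproj, Matrix.zero_mul]
  calc A = V * (b * b⁻¹) * (Vᵀ * A) := by
        rw [Matrix.mul_nonsing_inv b hb, Matrix.mul_one, ← Matrix.mul_assoc]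
        simpa only [Matrix.sub_mul, Matrix.one_mul, sub_eq_zero] using hrange
    _ = V * b * (Aᵀ * V * b⁻¹)ᵀ := by
        rw [Matrix.transpose_mul, Matrix.transpose_mul, Matrix.transpose_transpose,
          transpose_inv_of_transpose_eq hbt]
        simp only [Matrix.mul_assoc]

/-- The embeddings that exhibit balanced weights `W` as an isometric lift of a constant sequence
`b`: `W ⟨j, _⟩ = U (j + 1) * b * (U j)ᵀ` forces `(U j)ᵀ = b⁻¹ * (U (j + 1))ᵀ * W ⟨j, _⟩`. -/
noncomputable def balancedFrame (W : Params N d) (b : Matrix (Fin (d N)) (Fin (d N)) ℝ) {j : ℕ}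
    (hj : j ≤ N) : Matrix (Fin (d j)) (Fin (d N)) ℝ :=
  (suffixProd W hj)ᵀ * b⁻¹ ^ (N - j)

lemma balancedFrame_self (W : Params N d) (b : Matrix (Fin (d N)) (Fin (d N)) ℝ) :
    balancedFrame W b le_rfl = 1 := by
  rw [balancedFrame, suffixProd_self, Nat.sub_self, pow_zero, Matrix.transpose_one, Matrix.mul_one]

lemma balancedFrame_of_lt (W : Params N d) (b : Matrix (Fin (d N)) (Fin (d N)) ℝ) {j : ℕ}
    (hj : j < N) : balancedFrame W b hj.le =
      (W ⟨j, hj⟩)ᵀ * balancedFrame W b (Nat.succ_le_of_lt hj) * b⁻¹ := by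
  rw [balancedFrame, balancedFrame, suffixProd_of_lt W hj, show N - j = N - (j + 1) + 1 by omega,
    pow_succ, Matrix.transpose_mul]
  simp only [Matrix.mul_assoc]

variable {k : ℕ} {W : Params (k + 1) d} {b : Matrix (Fin (d (k + 1))) (Fin (d (k + 1))) ℝ}

lemma balancedFrame_succ_spec (hbal : BalancedWeights W) (hb : IsUnit b.det) (hbt : bᵀ = b)
    (hbW : b * b = W ⟨k, k.lt_succ_self⟩ * (W ⟨k, k.lt_succ_self⟩)ᵀ) {j : ℕ} (hj : j ≤ k) :
    (balancedFrame W b (Nat.succ_le_succ hj))ᵀ * balancedFrame W b (Nat.succ_le_succ hj) = 1 ∧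
      W ⟨j, Nat.lt_succ_of_le hj⟩ * (W ⟨j, Nat.lt_succ_of_le hj⟩)ᵀ =
        balancedFrame W b (Nat.succ_le_succ hj) * (b * b) *
          (balancedFrame W b (Nat.succ_le_succ hj))ᵀ := by
  induction hj using Nat.decreasingInduction with
  | self =>
    simp only [balancedFrame_self, hbW, Matrix.transpose_one, Matrix.one_mul, Matrix.mul_one,
      and_self]
  | of_succ j hj ih =>
    obtain ⟨hV, hW⟩ := ih
    have hlt : j + 1 < k + 1 := Nat.succ_lt_succ hj
    set V := balancedFrame W b (Nat.succ_le_of_lt hlt)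
    set V' := balancedFrame W b hlt.le with hV'
    rw [balancedFrame_of_lt W b hlt] at hV'
    refine ⟨hV' ▸ isometry_transpose_mul_mul_inv hb hbt hV hW, ?_⟩
    have hnext : W ⟨j + 1, hlt⟩ = V * b * V'ᵀ :=
      hV' ▸ eq_mul_mul_transpose_of_isometry hb hbt hV hW
    calc W ⟨j, _⟩ * (W ⟨j, _⟩)ᵀ = (W ⟨j + 1, hlt⟩)ᵀ * W ⟨j + 1, hlt⟩ := hbal j hlt
      _ = V' * (b * (Vᵀ * V) * b) * V'ᵀ := by
          rw [hnext, Matrix.transpose_mul, Matrix.transpose_mul, Matrix.transpose_transpose, hbt]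
          simp only [Matrix.mul_assoc]
      _ = V' * (b * b) * V'ᵀ := by rw [hV, Matrix.mul_one]

lemma isIsometricLift_balancedFrame (hbal : BalancedWeights W) (hb : IsUnit b.det) (hbt : bᵀ = b)
    (hbW : b * b = W ⟨k, k.lt_succ_self⟩ * (W ⟨k, k.lt_succ_self⟩)ᵀ) :
    IsIsometricLift (N := k + 1)
      (fun j => if hj : j ≤ k + 1 then
        (balancedFrame W b hj : Matrix (Fin (d j)) (Fin (d (k + 1))) ℝ) else 0) (fun _ => b) W where
  isometry j hj := by
    rw [dif_pos hj]
    rcases hj.eq_or_lt with rfl | hlt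
    · rw [balancedFrame_self, Matrix.transpose_one, Matrix.one_mul]
    · obtain ⟨hV, hW⟩ := balancedFrame_succ_spec hbal hb hbt hbW (Nat.le_of_lt_succ hlt)
      rw [balancedFrame_of_lt W b hlt]
      exact isometry_transpose_mul_mul_inv hb hbt hV hW
  last := by rw [dif_pos le_rfl, balancedFrame_self]
  eq j hj := by
    obtain ⟨hV, hW⟩ := balancedFrame_succ_spec hbal hb hbt hbW (Nat.le_of_lt_succ hj)
    rw [dif_pos (Nat.succ_le_of_lt hj), dif_pos hj.le, balancedFrame_of_lt W b hj]
    exact eq_mul_mul_transpose_of_isometry hb hbt hV hW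

lemma exists_isIsometricLift_of_balanced {W : Params N d} (hN : 1 ≤ N) (hbal : BalancedWeights W)
    (hW : (endToEnd W * (endToEnd W)ᵀ).PosDef) :
    ∃ (U : (j : ℕ) → Matrix (Fin (d j)) (Fin (d N)) ℝ) (b : Matrix (Fin (d N)) (Fin (d N)) ℝ),
      bᵀ = b ∧ IsIsometricLift U (fun _ => b) W := by
  obtain ⟨k, rfl⟩ := Nat.exists_eq_add_of_le' hN
  have hlast : (W ⟨k, k.lt_succ_self⟩ * (W ⟨k, k.lt_succ_self⟩)ᵀ).PosDef := by
    refine posDef_mul_transpose_of_isUnit_mul (B := partialProd W k k.le_succ * (endToEnd W)ᵀ) ?_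
    rw [← Matrix.mul_assoc]
    exact hW.isUnit
  exact ⟨_, _, transpose_sqrt _, isIsometricLift_balancedFrame hbal
    (isUnit_det_of_posDef (posDef_sqrt hlast)) (transpose_sqrt _) (sqrt_mul_sqrt hlast.posSemidef)⟩

end Balanced

end SquareReduction

section Margin

section SingularValues

variable {E F : Type*} [NormedAddCommGroup E] [InnerProductSpace ℝ E] [FiniteDimensional ℝ E]
  [NormedAddCommGroup F] [InnerProductSpace ℝ F] [FiniteDimensional ℝ F]

open scoped InnerProductSpace

lemma inner_self_apply_eq_sum_eigenvalues {S : E →ₗ[ℝ] E} (hS : S.IsSymmetric) {n : ℕ}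
    (hn : Module.finrank ℝ E = n) (v : E) :
    ⟪v, S v⟫_ℝ = ∑ i, hS.eigenvalues hn i * ⟪hS.eigenvectorBasis hn i, v⟫_ℝ ^ 2 := by
  rw [← (hS.eigenvectorBasis hn).sum_inner_mul_inner]
  refine Finset.sum_congr rfl fun i _ => ?_
  rw [← hS, hS.apply_eigenvectorBasis, RCLike.ofReal_real_eq_id, id, real_inner_smul_left,
    real_inner_comm v]
  ring

lemma singularValues_finrank_sub_one_mul_norm_le (T : E →ₗ[ℝ] F) (v : E) :
    T.singularValues (Module.finrank ℝ E - 1) * ‖v‖ ≤ ‖T v‖ := by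
  have hS := T.isSymmetric_adjoint_comp_self
  have heigenvalue (i : Fin (Module.finrank ℝ E)) :
      T.singularValues (Module.finrank ℝ E - 1) ^ 2 ≤ hS.eigenvalues rfl i := by
    rw [← T.sq_singularValues_fin rfl i]
    exact pow_le_pow_left₀ (T.singularValues_nonneg _) (T.singularValues_antitone (by omega)) 2
  refine le_of_sq_le_sq ?_ (norm_nonneg _)
  calc (T.singularValues (Module.finrank ℝ E - 1) * ‖v‖) ^ 2
      = ∑ i, T.singularValues (Module.finrank ℝ E - 1) ^ 2 *
          ⟪hS.eigenvectorBasis rfl i, v⟫_ℝ ^ 2 := by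
        simp only [mul_pow, ← (hS.eigenvectorBasis rfl).sum_sq_norm_inner_right v, Finset.mul_sum,
          Real.norm_eq_abs, sq_abs]
    _ ≤ ∑ i, hS.eigenvalues rfl i * ⟪hS.eigenvectorBasis rfl i, v⟫_ℝ ^ 2 :=
        Finset.sum_le_sum fun i _ => mul_le_mul_of_nonneg_right (heigenvalue i) (sq_nonneg _)
    _ = ‖T v‖ ^ 2 := by
        rw [← inner_self_apply_eq_sum_eigenvalues hS rfl, LinearMap.comp_apply,
          LinearMap.adjoint_inner_right, real_inner_self_eq_norm_sq]

end SingularValues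

variable {n q : ℕ} {S₀ : Matrix (Fin n) (Fin n) ℝ} {X : Matrix (Fin n) (Fin q) ℝ} {c : ℝ}

lemma sigmaMin_sq_smul_one_le (A : Matrix (Fin n) (Fin n) ℝ) :
    sigmaMin A ^ 2 • 1 ≤ Aᵀ * A := by
  have hnorm (v : Fin n → ℝ) :
      sigmaMin A * ‖WithLp.toLp 2 v‖ ≤ ‖WithLp.toLp 2 (A *ᵥ v)‖ := by
    have h := singularValues_finrank_sub_one_mul_norm_le (Matrix.toEuclideanLin A) (WithLp.toLp 2 v)
    rwa [finrank_euclideanSpace_fin] at h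
  have hle := smul_one_le_mul_transpose_iff (A := Aᵀ) (s := sigmaMin A)
    (LinearMap.singularValues_nonneg _ _)
  rw [Matrix.transpose_transpose] at hle
  exact hle.2 hnorm

lemma sigmaMin_sqrt_sq_smul_one_le (hS₀ : S₀.PosSemidef) :
    sigmaMin (CFC.sqrt S₀) ^ 2 • 1 ≤ S₀ := by
  simpa only [transpose_sqrt, sqrt_mul_sqrt hS₀] using sigmaMin_sq_smul_one_le (CFC.sqrt S₀)

lemma frobNorm_sqrt_sq (hS₀ : S₀.PosSemidef) : frobNorm (CFC.sqrt S₀) ^ 2 = S₀.trace := by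
  rw [frobNorm_sq_eq_trace_mul_transpose, transpose_sqrt, sqrt_mul_sqrt hS₀]

lemma sigmaMin_sqrt_le_frobNorm (hS₀ : S₀.PosSemidef) :
    sigmaMin (CFC.sqrt S₀) ≤ frobNorm (CFC.sqrt S₀) := by
  rcases Nat.eq_zero_or_pos n with rfl | hn
  · rw [sigmaMin, LinearMap.singularValues_of_finrank_le _ (by simp)]
    exact frobNorm_nonneg _
  · refine le_of_sq_le_sq ?_ (frobNorm_nonneg _)
    have htrace := trace_le_of_le (sigmaMin_sqrt_sq_smul_one_le hS₀)
    rw [Matrix.trace_smul, Matrix.trace_one, Fintype.card_fin, smul_eq_mul] at htrace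
    rw [frobNorm_sqrt_sq hS₀]
    exact (le_mul_of_one_le_right (sq_nonneg _) (Nat.one_le_cast.2 hn)).trans htrace

lemma sqrt_lossOne_le_of_margin (hS₀ : S₀.PosSemidef)
    (h : HasModifiedDeficiencyMargin S₀ (X * Xᵀ) c) :
    Real.sqrt (lossOne S₀ X) ≤ sigmaMin (CFC.sqrt S₀) - c := by
  refine le_trans (le_ciInf fun U => ?_) h
  have hloss := lossOne_le_frobNorm_sub_sq hS₀ (CFC.sqrt (X * Xᵀ))
    ((Matrix.mem_orthogonalGroup_iff _ _).1 U.2)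
  rw [lossOne, transpose_sqrt, sqrt_mul_sqrt (posSemidef_mul_transpose X)] at hloss
  exact Real.sqrt_le_iff.2 ⟨frobNorm_nonneg _, hloss⟩

lemma posDef_of_margin (hS₀ : S₀.PosSemidef) (hc : 0 < c)
    (h : HasModifiedDeficiencyMargin S₀ (X * Xᵀ) c) : (X * Xᵀ).PosDef := by
  obtain ⟨U, hU⟩ := exists_lt_of_ciInf_lt (lt_of_le_of_lt h (sub_lt_self _ hc))
  have hroot := sqrt_mul_mul_transpose_self hS₀ ((Matrix.mem_orthogonalGroup_iff _ _).1 U.2)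
  have hX := smul_one_le_mul_transpose_of_frobNorm_sub_le
    ((sigmaMin_sqrt_sq_smul_one_le hS₀).trans_eq hroot.symm) le_rfl hU.le
  rw [transpose_sqrt, sqrt_mul_sqrt (posSemidef_mul_transpose X)] at hX
  exact posDef_of_smul_one_le (pow_pos (sub_pos.2 hU) 2) hX

lemma sigmaMin_sqrt_pos_of_margin (hS₀ : S₀.PosSemidef) (hc : 0 < c)
    (h : HasModifiedDeficiencyMargin S₀ (X * Xᵀ) c) : 0 < sigmaMin (CFC.sqrt S₀) := by
  linarith [sqrt_lossOne_le_of_margin hS₀ h, Real.sqrt_nonneg (lossOne S₀ X)]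

lemma lossOne_nonneg_of_margin (hS₀ : S₀.PosSemidef) (hc : 0 < c)
    (h : HasModifiedDeficiencyMargin S₀ (X * Xᵀ) c) : 0 ≤ lossOne S₀ X := by
  have hS₀' := posDef_of_smul_one_le (pow_pos (sigmaMin_sqrt_pos_of_margin hS₀ hc h) 2)
    (sigmaMin_sqrt_sq_smul_one_le hS₀)
  rw [lossOne_eq_frobNorm_sub_nearestRoot_sq hS₀' (posDef_of_margin hS₀ hc h)]
  exact sq_nonneg _

end Margin

section Convergence

/-- Gradient descent on the squared distance of a product of `N` square matrices to a square root
`y` of `S₀` makes sufficient progress wherever the loss is at most `l ^ 2` and the imbalance is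
controlled by the decrease of the loss from `l ^ 2`. -/
def HasSufficientDecrease {n : ℕ} (S₀ : Matrix (Fin n) (Fin n) ℝ) (N : ℕ) (η ρ l : ℝ) : Prop :=
  ∀ (w : ℕ → Matrix (Fin n) (Fin n) ℝ) (y : Matrix (Fin n) (Fin n) ℝ), y * yᵀ = S₀ →
    frobNorm (segmentProd w 0 N - y) ≤ l →
    ∑ j ∈ Finset.range (N - 1), ‖imbalance w j‖ ≤
      4 * η * (l ^ 2 - frobNorm (segmentProd w 0 N - y) ^ 2) →
    SufficientDecrease η ρ w N y

lemma hasSufficientDecrease_single {n : ℕ} (S₀ : Matrix (Fin n) (Fin n) ℝ) {η : ℝ} (hη : 0 ≤ η)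
    (hη' : η ≤ 1 / 4) (l : ℝ) : HasSufficientDecrease S₀ 1 η 1 l :=
  fun _ _ _ _ _ => sufficientDecrease_single hη hη'

lemma StepsizeBound.hasSufficientDecrease {n p : ℕ} {S₀ : Matrix (Fin n) (Fin n) ℝ}
    {l σ m κ η : ℝ} (h : StepsizeBound p l σ (frobNorm (CFC.sqrt S₀)) m κ η)
    (hS₀ : S₀.PosSemidef) (hσ : σ ^ 2 • 1 ≤ S₀) :
    HasSufficientDecrease S₀ (p + 2) η (κ ^ (2 * p + 2)) l := by
  intro w y hy he hδ
  have hyF : frobNorm y = frobNorm (CFC.sqrt S₀) := by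
    rw [← sq_eq_sq₀ (frobNorm_nonneg _) (frobNorm_nonneg _), frobNorm_sqrt_sq hS₀,
      frobNorm_sq_eq_trace_mul_transpose, hy]
  have hlayer (j : ℕ) (hj : j < p + 2) : ‖w j‖ ≤ m ∧ κ ^ 2 • 1 ≤ w j * (w j)ᵀ :=
    h.norm_le_and_smul_one_le hyF (hσ.trans_eq hy.symm) he hδ hj
  exact h.sufficientDecrease he (fun j hj => (hlayer j hj).1) fun j hj => (hlayer j hj).2

variable {N : ℕ} {d : ℕ → ℕ}

/-- The properties of the iterates `W` that gradient descent preserves. The imbalance of the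
square matrices `w` is paid for by the decrease of the loss from its initial bound `l ^ 2`. -/
structure DescentInvariant (S₀ : Matrix (Fin (d N)) (Fin (d N)) ℝ) (η l : ℝ)
    (U : (j : ℕ) → Matrix (Fin (d j)) (Fin (d N)) ℝ) (w : ℕ → Matrix (Fin (d N)) (Fin (d N)) ℝ)
    (W : Params N d) : Prop where
  lift : IsIsometricLift U w W
  posDef : (endToEnd W * (endToEnd W)ᵀ).PosDef
  loss_le : lossN S₀ W ≤ l ^ 2
  imbalance_le : ∑ j ∈ Finset.range (N - 1), ‖imbalance w j‖ ≤ 4 * η * (l ^ 2 - lossN S₀ W)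

namespace DescentInvariant

variable {S₀ : Matrix (Fin (d N)) (Fin (d N)) ℝ} {η ρ l σ : ℝ}
  {U : (j : ℕ) → Matrix (Fin (d j)) (Fin (d N)) ℝ} {b : Matrix (Fin (d N)) (Fin (d N)) ℝ}
  {w : ℕ → Matrix (Fin (d N)) (Fin (d N)) ℝ} {W : Params N d}

lemma of_const (hη : 0 ≤ η) (hb : bᵀ = b) (hlift : IsIsometricLift U (fun _ => b) W)
    (hW : (endToEnd W * (endToEnd W)ᵀ).PosDef) (hloss : lossN S₀ W ≤ l ^ 2) :
    DescentInvariant S₀ η l U (fun _ => b) W where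
  lift := hlift
  posDef := hW
  loss_le := hloss
  imbalance_le := by
    simp only [imbalance, hb, sub_self, norm_zero, Finset.sum_const_zero]
    exact mul_nonneg (by positivity) (sub_nonneg.2 hloss)

lemma segmentProd_posDef (h : DescentInvariant S₀ η l U w W) :
    (segmentProd w 0 N * (segmentProd w 0 N)ᵀ).PosDef :=
  h.lift.endToEnd_mul_transpose ▸ h.posDef

lemma sufficientDecrease (h : DescentInvariant S₀ η l U w W) (hS₀ : S₀.PosDef) (hl : 0 ≤ l)
    (hdec : HasSufficientDecrease S₀ N η ρ l) :
    SufficientDecrease η ρ w N (nearestRoot S₀ (segmentProd w 0 N)) := by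
  have hloss := h.lift.lossN_eq hS₀ h.posDef
  refine hdec w _ (nearestRoot_mul_transpose_self hS₀ h.segmentProd_posDef) ?_
    (hloss ▸ h.imbalance_le)
  exact le_of_sq_le_sq (hloss ▸ h.loss_le) hl

lemma lossN_sub_smul_gradLossN_le (h : DescentInvariant S₀ η l U w W) (hS₀ : S₀.PosDef)
    (hdec : SufficientDecrease η ρ w N (nearestRoot S₀ (segmentProd w 0 N))) :
    lossN S₀ (W - η • gradLossN S₀ W) ≤ lossN S₀ W - η / 2 * ∑ j ∈ Finset.range N,
      frobNorm (distGrad w N (nearestRoot S₀ (segmentProd w 0 N)) j) ^ 2 :=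
  calc lossN S₀ (W - η • gradLossN S₀ W) ≤ _ :=
        (h.lift.sub_smul_gradLossN hS₀ h.posDef η).lossN_le hS₀ h.segmentProd_posDef
    _ ≤ _ := hdec.step_le
    _ = _ := by rw [h.lift.lossN_eq hS₀ h.posDef]

lemma lossN_sub_smul_gradLossN_le_mul (h : DescentInvariant S₀ η l U w W) (hS₀ : S₀.PosDef)
    (hη : 0 ≤ η) (hdec : SufficientDecrease η ρ w N (nearestRoot S₀ (segmentProd w 0 N))) :
    lossN S₀ (W - η • gradLossN S₀ W) ≤ (1 - 2 * η * N * ρ) * lossN S₀ W := by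
  have hloss := h.lossN_sub_smul_gradLossN_le hS₀ hdec
  have hgrad := mul_le_mul_of_nonneg_left hdec.loss_le hη
  rw [← h.lift.lossN_eq hS₀ h.posDef] at hgrad
  linarith

lemma endToEnd_sub_smul_gradLossN_posDef (h : DescentInvariant S₀ η l U w W) (hS₀ : S₀.PosDef)
    (hη : 0 ≤ η) (hl : 0 ≤ l) (hlσ : l < σ) (hσ : σ ^ 2 • 1 ≤ S₀)
    (hdec : SufficientDecrease η ρ w N (nearestRoot S₀ (segmentProd w 0 N))) :
    (endToEnd (W - η • gradLossN S₀ W) * (endToEnd (W - η • gradLossN S₀ W))ᵀ).PosDef := by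
  have hstep := hdec.step_le
  rw [← h.lift.lossN_eq hS₀ h.posDef] at hstep
  have hgrad : 0 ≤ η / 2 * ∑ j ∈ Finset.range N,
      frobNorm (distGrad w N (nearestRoot S₀ (segmentProd w 0 N)) j) ^ 2 := by positivity
  have hroot := nearestRoot_mul_transpose_self hS₀ h.segmentProd_posDef
  rw [(h.lift.sub_smul_gradLossN hS₀ h.posDef η).endToEnd_mul_transpose]
  refine posDef_of_smul_one_le (pow_pos (sub_pos.2 hlσ) 2)
    (smul_one_le_mul_transpose_of_frobNorm_sub_le (hσ.trans_eq hroot.symm) ?_ hlσ.le)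
  exact le_of_sq_le_sq (by linarith [h.loss_le]) hl

lemma sub_smul_gradLossN (h : DescentInvariant S₀ η l U w W) (hη : 0 ≤ η) (hl : 0 ≤ l)
    (hlσ : l < σ) (hσ : σ ^ 2 • 1 ≤ S₀) (hdec : HasSufficientDecrease S₀ N η ρ l) :
    DescentInvariant S₀ η l U (w - η • distGrad w N (nearestRoot S₀ (segmentProd w 0 N)))
      (W - η • gradLossN S₀ W) := by
  have hS₀ := posDef_of_smul_one_le (pow_pos (hl.trans_lt hlσ) 2) hσ
  have hdec' := h.sufficientDecrease hS₀ hl hdec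
  have hloss := h.lossN_sub_smul_gradLossN_le hS₀ hdec'
  set G := ∑ j ∈ Finset.range N,
    frobNorm (distGrad w N (nearestRoot S₀ (segmentProd w 0 N)) j) ^ 2
  have hG : 0 ≤ η / 2 * G := by positivity
  refine ⟨h.lift.sub_smul_gradLossN hS₀ h.posDef η,
    h.endToEnd_sub_smul_gradLossN_posDef hS₀ hη hl hlσ hσ hdec', by linarith [h.loss_le], ?_⟩
  calc _ ≤ _ := sum_norm_imbalance_sub_smul_distGrad_le η
    _ ≤ 4 * η * (l ^ 2 - lossN S₀ W) + 4 * η * (η / 2 * G) := by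
        linarith [h.imbalance_le]
    _ ≤ 4 * η * (l ^ 2 - lossN S₀ (W - η • gradLossN S₀ W)) := by
        rw [← mul_add]
        exact mul_le_mul_of_nonneg_left (by linarith) (by positivity)

end DescentInvariant

variable {S₀ : Matrix (Fin (d N)) (Fin (d N)) ℝ} {η ρ l σ : ℝ} {W : ℕ → Params N d}

lemma IsGradientDescent.exists_descentInvariant (hW : IsGradientDescent S₀ η W) (hN : 1 ≤ N)
    (hbal : BalancedWeights (W 0)) (hpd : (endToEnd (W 0) * (endToEnd (W 0))ᵀ).PosDef)
    (hη : 0 ≤ η) (hl : 0 ≤ l) (hlσ : l < σ) (hσ : σ ^ 2 • 1 ≤ S₀) (hloss : lossN S₀ (W 0) ≤ l ^ 2)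
    (hdec : HasSufficientDecrease S₀ N η ρ l) (k : ℕ) :
    ∃ U w, DescentInvariant S₀ η l U w (W k) := by
  induction k with
  | zero =>
    obtain ⟨U, b, hb, hlift⟩ := exists_isIsometricLift_of_balanced hN hbal hpd
    exact ⟨U, fun _ => b, .of_const hη hb hlift hpd hloss⟩
  | succ k ih =>
    obtain ⟨U, w, h⟩ := ih
    exact ⟨U, _, hW k ▸ h.sub_smul_gradLossN hη hl hlσ hσ hdec⟩

lemma IsGradientDescent.differentiableAt_and_lossN_le (hW : IsGradientDescent S₀ η W) (hN : 1 ≤ N)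
    (hbal : BalancedWeights (W 0)) (hpd : (endToEnd (W 0) * (endToEnd (W 0))ᵀ).PosDef)
    (hη : 0 ≤ η) (hl : 0 ≤ l) (hlσ : l < σ) (hσ : σ ^ 2 • 1 ≤ S₀) (hloss : lossN S₀ (W 0) ≤ l ^ 2)
    (hdec : HasSufficientDecrease S₀ N η ρ l) (hρ : 2 * η * N * ρ ≤ 1) (k : ℕ) :
    DifferentiableAt ℝ (lossN S₀ : Params N d → ℝ) (W k) ∧
      lossN S₀ (W k) ≤ (1 - 2 * η * N * ρ) ^ k * lossN S₀ (W 0) := by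
  have hS₀ := posDef_of_smul_one_le (pow_pos (hl.trans_lt hlσ) 2) hσ
  have hinv := hW.exists_descentInvariant hN hbal hpd hη hl hlσ hσ hloss hdec
  obtain ⟨U, w, h⟩ := hinv k
  refine ⟨differentiableAt_lossN hS₀ h.posDef,
    le_geom (u := fun k => lossN S₀ (W k)) (sub_nonneg.2 hρ) k fun i _ => ?_⟩
  obtain ⟨U, w, h⟩ := hinv i
  simp only [hW i]
  exact h.lossN_sub_smul_gradLossN_le_mul hS₀ hη (h.sufficientDecrease hS₀ hl hdec)

end Convergence

section StepSizeCondition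

lemma one_sub_pow_mul_le_of_log_le {a q ε : ℝ} {k : ℕ} (hq : 0 < q) (hq1 : q ≤ 1) (ha : 0 ≤ a)
    (hε : 0 < ε) (hk : 1 / q * Real.log (a / ε) ≤ k) : (1 - q) ^ k * a ≤ ε := by
  rcases ha.eq_or_lt with rfl | ha
  · simpa using hε.le
  · rw [one_div_mul_eq_div, div_le_iff₀ hq] at hk
    calc (1 - q) ^ k * a ≤ Real.exp (-q) ^ k * a := by
          refine mul_le_mul_of_nonneg_right ?_ ha.le
          exact pow_le_pow_left₀ (sub_nonneg.2 hq1) (Real.one_sub_le_exp_neg q) k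
      _ = Real.exp (-(k * q)) * a := by rw [← Real.exp_nat_mul, mul_neg]
      _ ≤ Real.exp (-Real.log (a / ε)) * a := by gcongr
      _ = ε := by
          rw [Real.exp_neg, Real.exp_log (by positivity), inv_div, div_mul_cancel₀ _ ha.ne']

lemma rpow_inv_pow {x : ℝ} (hx : 0 ≤ x) (N k : ℕ) : (x ^ (N : ℝ)⁻¹) ^ k = x ^ ((k : ℝ) / N) := by
  rw [← Real.rpow_natCast, ← Real.rpow_mul hx, inv_mul_eq_div]

lemma hasSufficientDecrease_of_rpow_le {n N : ℕ} {S₀ : Matrix (Fin n) (Fin n) ℝ} {c η l M : ℝ}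
    (hN : 1 ≤ N) (hS₀ : S₀.PosSemidef) (hc : 0 < c) (hη : 0 ≤ η) (hl : 0 ≤ l) (hM : 0 < M)
    (hM2 : M ^ 2 = 2 * (l ^ 2 + frobNorm (CFC.sqrt S₀) ^ 2))
    (hmargin : l + c ≤ sigmaMin (CFC.sqrt S₀))
    (hη₁ : η * (16 * ((N : ℝ) - 1) * M ^ ((3 * (N : ℝ) - 4) / N) * frobNorm (CFC.sqrt S₀)) ≤
      c ^ (2 * ((N : ℝ) - 1) / N))
    (hη₂ : η ≤ 1 / (4 * (N : ℝ) * c ^ (2 * ((N : ℝ) - 1) / N))) :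
    HasSufficientDecrease S₀ N η (c ^ (2 * ((N : ℝ) - 1) / N)) l := by
  obtain ⟨p, rfl⟩ := Nat.exists_eq_add_of_le' hN
  rcases p with _ | p
  · simp only [zero_add, Nat.cast_one, sub_self, mul_zero, zero_div, Real.rpow_zero, mul_one]
      at hη₂ ⊢
    exact hasSufficientDecrease_single S₀ hη hη₂ l
  · have hκ : (c ^ ((p + 2 : ℕ) : ℝ)⁻¹) ^ (2 * p + 2) =
        c ^ (2 * (((p + 2 : ℕ) : ℝ) - 1) / (p + 2 : ℕ)) := by
      rw [rpow_inv_pow hc.le]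
      push_cast
      ring_nf
    have hm : (M ^ ((p + 2 : ℕ) : ℝ)⁻¹) ^ (3 * p + 2) =
        M ^ ((3 * ((p + 2 : ℕ) : ℝ) - 4) / (p + 2 : ℕ)) := by
      rw [rpow_inv_pow hM.le]
      push_cast
      ring_nf
    have hbound : StepsizeBound p l (sigmaMin (CFC.sqrt S₀)) (frobNorm (CFC.sqrt S₀))
        (M ^ ((p + 2 : ℕ) : ℝ)⁻¹) (c ^ ((p + 2 : ℕ) : ℝ)⁻¹) η := by
      refine ⟨hl, hη, by positivity, by positivity, ?_, sigmaMin_sqrt_le_frobNorm hS₀, ?_, ?_⟩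
      · rwa [Real.rpow_inv_natCast_pow hc.le (by omega)]
      · rwa [Real.rpow_inv_natCast_pow hM.le (by omega)]
      · rw [hκ, hm]
        convert hη₁ using 4
        push_cast
        ring
    exact hκ ▸ hbound.hasSufficientDecrease hS₀ (sigmaMin_sqrt_sq_smul_one_le hS₀)

lemma hasSufficientDecrease_of_margin {n q N : ℕ} {S₀ : Matrix (Fin n) (Fin n) ℝ}
    {X : Matrix (Fin n) (Fin q) ℝ} {c η : ℝ} (hN : 1 ≤ N) (hS₀ : S₀.PosSemidef) (hc : 0 < c)
    (hη : 0 ≤ η) (hmargin : HasModifiedDeficiencyMargin S₀ (X * Xᵀ) c)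
    (hη₁ : η * (16 * ((N : ℝ) - 1) * boundM S₀ X ^ ((3 * (N : ℝ) - 4) / N) *
      frobNorm (CFC.sqrt S₀)) ≤ c ^ (2 * ((N : ℝ) - 1) / N))
    (hη₂ : η ≤ 1 / (4 * (N : ℝ) * c ^ (2 * ((N : ℝ) - 1) / N))) :
    HasSufficientDecrease S₀ N η (c ^ (2 * ((N : ℝ) - 1) / N)) (Real.sqrt (lossOne S₀ X)) := by
  have hloss := lossOne_nonneg_of_margin hS₀ hc hmargin
  have hF : 0 < frobNorm (CFC.sqrt S₀) :=
    (sigmaMin_sqrt_pos_of_margin hS₀ hc hmargin).trans_le (sigmaMin_sqrt_le_frobNorm hS₀)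
  have hM2 : boundM S₀ X ^ 2 =
      2 * (Real.sqrt (lossOne S₀ X) ^ 2 + frobNorm (CFC.sqrt S₀) ^ 2) := by
    rw [boundM, Real.sq_sqrt (by positivity), Real.sq_sqrt hloss]
  exact hasSufficientDecrease_of_rpow_le hN hS₀ hc hη (Real.sqrt_nonneg _)
    (Real.sqrt_pos.2 (by positivity)) hM2
    (le_sub_iff_add_le.1 (sqrt_lossOne_le_of_margin hS₀ hmargin)) hη₁ hη₂

lemma mul_le_of_le_div_boundDelta {n N : ℕ} {S₀ : Matrix (Fin n) (Fin n) ℝ} {c η M : ℝ}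
    (hN : 1 ≤ N) (hc : 0 < c) (hM : 0 ≤ M) (hη : 0 ≤ η)
    (h : η ≤ (N : ℝ) * c ^ (2 * ((N : ℝ) - 1) / N) / (2 * boundDelta N c M S₀)) :
    η * (16 * ((N : ℝ) - 1) * M ^ ((3 * (N : ℝ) - 4) / N) * frobNorm (CFC.sqrt S₀)) ≤
      c ^ (2 * ((N : ℝ) - 1) / N) := by
  have hF := frobNorm_nonneg (CFC.sqrt S₀)
  have hN1 : (0 : ℝ) ≤ N - 1 := sub_nonneg.2 (Nat.one_le_cast.2 hN)
  have hN0 : (0 : ℝ) < N := Nat.cast_pos.2 hN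
  set A := M ^ ((3 * (N : ℝ) - 4) / N)
  set C := c ^ (2 * ((N : ℝ) - 1) / N)
  have hΔ : 8 * N * (N - 1) * A * frobNorm (CFC.sqrt S₀) ≤ boundDelta N c M S₀ :=
    calc 8 * N * (N - 1) * A * frobNorm (CFC.sqrt S₀)
        ≤ 8 * N * (N - 1) * A * (M ^ (1 / (N : ℝ)) + frobNorm (CFC.sqrt S₀)) :=
          mul_le_mul_of_nonneg_left (le_add_of_nonneg_left (by positivity)) (by positivity)
      _ ≤ boundDelta N c M S₀ := le_add_of_nonneg_left (by positivity)
  have hΔ0 : 0 ≤ boundDelta N c M S₀ := le_trans (by positivity) hΔ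
  refine le_of_mul_le_mul_left (a := (N : ℝ)) ?_ hN0
  calc N * (η * (16 * (N - 1) * A * frobNorm (CFC.sqrt S₀)))
      = η * (2 * (8 * N * (N - 1) * A * frobNorm (CFC.sqrt S₀))) := by ring
    _ ≤ η * (2 * boundDelta N c M S₀) := by gcongr
    _ ≤ N * C := mul_le_of_le_div₀ (by positivity) (by positivity) h

end StepSizeCondition

end

theorem mainTheorem4_general (N : ℕ) (hN : 1 ≤ N) (d : ℕ → ℕ)
    (S₀ : Matrix (Fin (d N)) (Fin (d N)) ℝ) (hS₀ : S₀.PosSemidef)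
    (c η : ℝ) (hc : 0 < c) (hη : 0 < η)
    (W : ℕ → Params N d) (hW : IsGradientDescent S₀ η W)
    (hbal : BalancedWeights (W 0))
    (hmargin : HasModifiedDeficiencyMargin S₀ (endToEnd (W 0) * (endToEnd (W 0))ᵀ) c)
    (hη₁ : η * (16 * ((N : ℝ) - 1) * boundM S₀ (endToEnd (W 0)) ^ ((3 * (N : ℝ) - 4) / N) *
      frobNorm (CFC.sqrt S₀)) ≤ c ^ (2 * ((N : ℝ) - 1) / N))
    (hη₂ : η ≤ 1 / (4 * (N : ℝ) * c ^ (2 * ((N : ℝ) - 1) / N))) :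
    (∀ k : ℕ, DifferentiableAt ℝ (lossN S₀ : Params N d → ℝ) (W k)) ∧
    ∀ ε : ℝ, 0 < ε → ∀ k : ℕ,
      1 / (2 * η * (N : ℝ) * c ^ (2 * ((N : ℝ) - 1) / N)) *
          Real.log (lossOne S₀ (endToEnd (W 0)) / ε) ≤ (k : ℝ) →
        lossN S₀ (W k) ≤ ε := by
  have hpd := posDef_of_margin hS₀ hc hmargin
  have hloss := lossOne_nonneg_of_margin hS₀ hc hmargin
  have hlσ := sqrt_lossOne_le_of_margin hS₀ hmargin
  have hdec := hasSufficientDecrease_of_margin hN hS₀ hc hη.le hmargin hη₁ hη₂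
  have hN' : (0 : ℝ) < N := Nat.cast_pos.2 hN
  have hrate : 2 * η * N * c ^ (2 * ((N : ℝ) - 1) / N) ≤ 1 := by
    rw [le_div_iff₀ (by positivity)] at hη₂
    linarith
  have hconv := hW.differentiableAt_and_lossN_le hN hbal hpd hη.le (Real.sqrt_nonneg _)
    (hlσ.trans_lt (sub_lt_self _ hc)) (sigmaMin_sqrt_sq_smul_one_le hS₀)
    (Real.sq_sqrt hloss).ge hdec hrate
  exact ⟨fun k => (hconv k).1, fun ε hε k hk => (hconv k).2.trans
    (one_sub_pow_mul_le_of_log_le (by positivity) hrate hloss hε hk)⟩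

theorem mainTheorem4 (N : ℕ) (hN : 1 ≤ N) (d : ℕ → ℕ)
    (S₀ : Matrix (Fin (d N)) (Fin (d N)) ℝ) (hS₀ : S₀.PosSemidef)
    (c η : ℝ) (hc : 0 < c) (hη : 0 < η)
    (W : ℕ → Params N d) (hW : IsGradientDescent S₀ η W)
    (hbal : BalancedWeights (W 0))
    (hmargin : HasModifiedDeficiencyMargin S₀ (endToEnd (W 0) * (endToEnd (W 0))ᵀ) c)
    -- `η ≤ c² / (8 M L¹(W(0))^{1/2})`, no restriction if `L¹(W(0)) = 0`
    (hη₁ : η * (8 * boundM S₀ (endToEnd (W 0)) * Real.sqrt (lossOne S₀ (endToEnd (W 0)))) ≤ c ^ 2)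
    (hη₂ : η ≤ (N : ℝ) * c ^ (2 * ((N : ℝ) - 1) / N) /
      (2 * boundDelta N c (boundM S₀ (endToEnd (W 0))) S₀))
    (hη₃ : η ≤ 1 / (4 * (N : ℝ) * c ^ (2 * ((N : ℝ) - 1) / N))) :
    (∀ k : ℕ, DifferentiableAt ℝ (lossN S₀ : Params N d → ℝ) (W k)) ∧
    ∀ ε : ℝ, 0 < ε → ∀ k : ℕ,
      1 / (2 * η * (N : ℝ) * c ^ (2 * ((N : ℝ) - 1) / N)) *
          Real.log (lossOne S₀ (endToEnd (W 0)) / ε) ≤ (k : ℝ) →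
        lossN S₀ (W k) ≤ ε :=
  mainTheorem4_general N hN d S₀ hS₀ c η hc hη W hW hbal hmargin
    (mul_le_of_le_div_boundDelta hN hc (Real.sqrt_nonneg _) hη.le hη₂) hη₃
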